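/- All logarithms are natural unless a base is written. For a finite $d$-regular simple graph $G$ on $n$ vertices let $\lambda_1\ge\lambda_2\ge\dots\ge\lambda_n$ be the eigenvalues of its adjacency matrix and $\lambda(G)=\max_{i>1}|\lambda_i|$. A non-backtracking random walk $(w_0,w_1,\dots,w_n)$ of length $n$ on $G$ starts at a given vertex $w_0$; $w_1$ is uniform over the neighbours of $w_0$, and for $i\ge 2$ the vertex $w_i$ is chosen uniformly over all neighbours of $w_{i-1}$ other than $w_{i-2}$. Let $$N_t=\bigl|\{v\in V(G):|\{1\le i\le n: w_i=v\}|=t\}\bigr|,\qquad F(x)=\Bigl(1+x\,\frac{\log\log\log n}{\log\log n}\Bigr)\frac{\log n}{\log\log n}.$$ **Theorem.** Fix an integer $d\ge 3$, a real $\lambda<d$ and $\delta>0$. For every $\varepsilon>0$ there is $n_0=n_0(d,\lambda,\delta,\varepsilon)$ such that for every $n\ge n_0$, every $d$-regular graph $G$ on $n$ vertices with $\lambda(G)\le\lambda$ and girth larger than $10\log_{d-1}\log n$, and every starting vertex $w_0$ of $G$, the following two assertions hold simultaneously with probability at least $1-\varepsilon$: $$\left|\frac{N_t}{n/(\mathrm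 e\,t!)}-1\right|\le\frac1{\log\log\log n}\quad\text{for all integers } 0\le t<F(1-\delta),$$ $$N_t=0\quad\text{for all integers } t>F(1+\delta).$$ -/

import Mathlib

open scoped Nat

noncomputable section

/-- The real adjacency matrix of a graph is Hermitian, so it has real eigenvalues. -/
theorem adjMatrix_real_isHermitian {V : Type*} [Fintype V] [DecidableEq V]
    (G : SimpleGraph V) [DecidableRel G.Adj] : (G.adjMatrix ℝ).IsHermitian := by
  unfold Matrix.IsHermitian
  rw [Matrix.conjTranspose_eq_transpose_of_trivial]
  exact G.isSymm_adjMatrix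

/-- The adjacency eigenvalues `λ₁ ≥ λ₂ ≥ … ≥ λₙ` with multiplicity in decreasing order, indexed
from `0`: `adjEigenvalue G 0` is `λ₁`. -/
def adjEigenvalue {V : Type*} [Fintype V] [DecidableEq V]
    (G : SimpleGraph V) [DecidableRel G.Adj] : Fin (Fintype.card V) → ℝ :=
  (adjMatrix_real_isHermitian G).eigenvalues₀

/-- `G` is an `(n, d, lam)` graph, `n` being the number of vertices: it is `d`-regular, and the
largest absolute value `max_{i > 1} |λᵢ|` of a nontrivial eigenvalue is `lam`. -/
structure IsNDLambdaGraph {V : Type*} [Fintype V] [DecidableEq V]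
    (G : SimpleGraph V) [DecidableRel G.Adj] (n d : ℕ) (lam : ℝ) : Prop where
  card_eq : Fintype.card V = n
  regular : G.IsRegularOfDegree d
  isGreatest : IsGreatest
    {x : ℝ | ∃ i : Fin (Fintype.card V), 0 < (i : ℕ) ∧ x = |adjEigenvalue G i|} lam

/-- The vertices that a non-backtracking walk with positions `w 0, …, w i` may move to in its step
from time `i` to time `i + 1`: the neighbours of `w i` other than `w (i - 1)`
(and all neighbours of `w 0` if `i = 0`). -/
def nbChoices {V : Type*} [Fintype V] [DecidableEq V]
    (G : SimpleGraph V) [DecidableRel G.Adj] {k : ℕ} (w : Fin (k + 1) → V) (i : Fin k) :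
    Finset V :=
  {u ∈ G.neighborFinset (w i.castSucc) | ∀ j : Fin (k + 1), (j : ℕ) + 1 = i → u ≠ w j}

/-- The probability that the non-backtracking random walk of length `k` from `w₀` is the sequence
`w`: every step is uniform over the vertices available to it. -/
def nbWalkProb {V : Type*} [Fintype V] [DecidableEq V]
    (G : SimpleGraph V) [DecidableRel G.Adj] (w₀ : V) (k : ℕ) (w : Fin (k + 1) → V) : ℝ :=
  (if w 0 = w₀ then 1 else 0) *
    ∏ i : Fin k, if w i.succ ∈ nbChoices G w i then ((nbChoices G w i).card : ℝ)⁻¹ else 0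

open Classical in
/-- The probability of the event `E` for the non-backtracking random walk of length `k` from
`w₀`. -/
def nbProb {V : Type*} [Fintype V] [DecidableEq V]
    (G : SimpleGraph V) [DecidableRel G.Adj] (w₀ : V) (k : ℕ) (E : Set (Fin (k + 1) → V)) : ℝ :=
  ∑ w : Fin (k + 1) → V, if w ∈ E then nbWalkProb G w₀ k w else 0

/-- The number of times `1 ≤ i ≤ k` at which `w` is at `v`. -/
def visitCount {V : Type*} [DecidableEq V] {k : ℕ} (w : Fin (k + 1) → V) (v : V) : ℕ :=
  (Finset.univ.filter fun i : Fin k => w i.succ = v).card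

/-- `N_t`: the number of vertices that `w` visits precisely `t` times. -/
def visitedExactly {V : Type*} [Fintype V] [DecidableEq V] {k : ℕ} (w : Fin (k + 1) → V)
    (t : ℕ) : ℕ :=
  (Finset.univ.filter fun v : V => visitCount w v = t).card

/-- `F(x) = (1 + x · log log log n / log log n) · log n / log log n`. -/
def visitThreshold (n : ℕ) (x : ℝ) : ℝ :=
  (1 + x * (Real.log (Real.log (Real.log n)) / Real.log (Real.log n))) *
    (Real.log n / Real.log (Real.log n))

theorem nbChoices_card_pos {V : Type*} [Fintype V] [DecidableEq V]
    (G : SimpleGraph V) [DecidableRel G.Adj] (hG : ∀ v, 2 ≤ G.degree v) {k : ℕ}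
    (w : Fin (k + 1) → V) (i : Fin k) : 0 < (nbChoices G w i).card := by
  have key : ∃ x, (G.neighborFinset (w i.castSucc)).erase x ⊆ nbChoices G w i := by
    by_cases hi : (i : ℕ) = 0
    · refine ⟨w 0, fun u hu => ?_⟩
      simp only [nbChoices, Finset.mem_filter]
      exact ⟨Finset.mem_of_mem_erase hu, fun j hj => by omega⟩
    · refine ⟨w ⟨i - 1, by omega⟩, fun u hu => ?_⟩
      simp only [nbChoices, Finset.mem_filter]
      refine ⟨Finset.mem_of_mem_erase hu, fun j hj => ?_⟩
      have : j = ⟨i - 1, by omega⟩ := Fin.ext (by simp; omega)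
      rw [this]
      exact Finset.ne_of_mem_erase hu
  obtain ⟨x, hx⟩ := key
  have h1 := Finset.card_le_card hx
  have h2 := Finset.pred_card_le_card_erase (s := G.neighborFinset (w i.castSucc)) (a := x)
  have h3 := hG (w i.castSucc)
  rw [← G.card_neighborFinset_eq_degree] at h3
  omega

theorem nbChoices_snoc_castSucc {V : Type*} [Fintype V] [DecidableEq V]
    (G : SimpleGraph V) [DecidableRel G.Adj] {k : ℕ} (w : Fin (k + 1) → V) (u : V) (i : Fin k) :
    nbChoices G (Fin.snoc (α := fun _ => V) w u : Fin (k + 2) → V) i.castSucc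
      = nbChoices G w i := by
  have h0 : (Fin.snoc (α := fun _ => V) w u : Fin (k + 2) → V) i.castSucc.castSucc
      = w i.castSucc := Fin.snoc_castSucc (α := fun _ => V) u w i.castSucc
  ext x
  simp only [nbChoices, Finset.mem_filter, SimpleGraph.mem_neighborFinset, h0, Fin.val_castSucc]
  refine and_congr_right fun _ => Iff.intro (fun h j hj => ?_) (fun h j hj => ?_)
  · simpa using h j.castSucc (by simpa using hj)
  · have hjk : (j : ℕ) < k + 1 := by omega
    have : j = (⟨j, hjk⟩ : Fin (k + 1)).castSucc := rfl
    rw [this, Fin.snoc_castSucc]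
    exact h _ hj

theorem nbChoices_snoc_last {V : Type*} [Fintype V] [DecidableEq V]
    (G : SimpleGraph V) [DecidableRel G.Adj] {k : ℕ} (w : Fin (k + 1) → V) (u u' : V) :
    nbChoices G (Fin.snoc (α := fun _ => V) w u : Fin (k + 2) → V) (Fin.last k)
      = nbChoices G (Fin.snoc (α := fun _ => V) w u' : Fin (k + 2) → V) (Fin.last k) := by
  have h0 : ∀ u, (Fin.snoc (α := fun _ => V) w u : Fin (k + 2) → V) (Fin.last k).castSucc
      = w (Fin.last k) := fun u => Fin.snoc_castSucc (α := fun _ => V) u w (Fin.last k)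
  ext x
  simp only [nbChoices, Finset.mem_filter, SimpleGraph.mem_neighborFinset, h0, Fin.val_last]
  refine and_congr_right fun _ => forall_congr' fun j => imp_congr_right fun hj => ?_
  have hjk : (j : ℕ) < k + 1 := by omega
  have : j = (⟨j, hjk⟩ : Fin (k + 1)).castSucc := rfl
  rw [this, Fin.snoc_castSucc, Fin.snoc_castSucc]

/-- The walk probabilities sum to `1` when all degrees are at least `2`. -/
theorem sum_nbWalkProb {V : Type*} [Fintype V] [DecidableEq V]
    (G : SimpleGraph V) [DecidableRel G.Adj] (hG : ∀ v, 2 ≤ G.degree v) (w₀ : V) (k : ℕ) :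
    ∑ w : Fin (k + 1) → V, nbWalkProb G w₀ k w = 1 := by
  induction k with
  | zero =>
    rw [← (Equiv.funUnique (Fin 1) V).symm.sum_comp]
    simp [nbWalkProb]
  | succ k ih =>
    rw [← ih, ← (Fin.snocEquiv fun _ : Fin (k + 2) => V).sum_comp, Fintype.sum_prod_type_right]
    refine Finset.sum_congr rfl fun w _ => ?_
    have hstep : ∀ u : V, nbWalkProb G w₀ (k + 1) (Fin.snoc (α := fun _ => V) w u)
        = nbWalkProb G w₀ k w *
          (if u ∈ nbChoices G (Fin.snoc (α := fun _ => V) w w₀ : Fin (k + 2) → V) (Fin.last k)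
            then ((nbChoices G (Fin.snoc (α := fun _ => V) w w₀ : Fin (k + 2) → V)
              (Fin.last k)).card : ℝ)⁻¹ else 0) := by
      intro u
      unfold nbWalkProb
      rw [Fin.prod_univ_castSucc, nbChoices_snoc_last G w u w₀, Fin.succ_last, Fin.snoc_last,
        ← mul_assoc]
      have h0 : (Fin.snoc (α := fun _ => V) w u : Fin (k + 2) → V) 0 = w 0 :=
        Fin.snoc_castSucc (α := fun _ => V) u w 0
      rw [h0]
      congr 2
      · refine Finset.prod_congr rfl fun i _ => ?_
        rw [nbChoices_snoc_castSucc, Fin.succ_castSucc, Fin.snoc_castSucc]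
    have : ∀ u : V, (Fin.snocEquiv fun _ : Fin (k + 2) => V) (u, w)
        = Fin.snoc (α := fun _ => V) w u := fun _ => rfl
    simp only [this, hstep]
    rw [← Finset.mul_sum]
    have hp := nbChoices_card_pos G hG
      (Fin.snoc (α := fun _ => V) w w₀ : Fin (k + 2) → V) (Fin.last k)
    have hp' : ((nbChoices G (Fin.snoc (α := fun _ => V) w w₀ : Fin (k + 2) → V)
        (Fin.last k)).card : ℝ) ≠ 0 := by exact_mod_cast hp.ne'
    simp [Finset.sum_ite_mem, mul_inv_cancel₀ hp']

end

noncomputable section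

/-! Write L = log n. Two facts govern the walk. Expansion brings it within n⁻² of uniform after O(L)
steps. Large girth forbids a return within the first h steps, where h is about 5 log_{d-1} L, and
bounds every later hitting probability by (d-1)⁻ʰ, which is O(L⁻⁵). Visits to a typical vertex u are
therefore rare and almost independent, and their number X_u is nearly Poisson of mean 1.

Mixing (`exists_nbHit_mixing`) is a spectral argument. Summing hitting probabilities over the arcs
leaving a vertex gives a function of vertices that satisfies a three-term recursion in the adjacency
operator. Its coefficient along each nontrivial eigenvector satisfies a scalar recursion and decays
geometrically.

The Poisson approximation is made through factorial moments. The product C(X_u, r) C(X_v, s) counts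
choices of visit times, and conditioning on the earliest chosen visit expresses its expectation as a
convolution of hitting probabilities with moments of total order r + s - 1. Induction, with sums of
powers compared to integrals, gives (1 + O(L⁻²)) / (r! s!) when u, v and the start are pairwise far
apart (`nbMoment_le`, `le_nbMoment`). The error is relative and uniform for r + s of order L; this
is essential because t! may come close to n.

Bonferroni's inequalities turn these moments into a lower bound for P(X_u = t) and an upper bound
for P(X_u = X_v = t), which are all that a variance bound for N_t needs. The exceptional pairs
number at most 3 n dʰ, with dʰ ≤ L¹⁰, and are harmless because t! ≤ n / L²⁰ below the lower
threshold. Chebyshev's inequality and a union bound over O(L) values of t give the first assertion.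
For the second, Markov's inequality is applied to C(X_u, T) for the least integer T above the upper
threshold, where T! ≥ n L²⁰. -/

/-- A two-term linear recursion with characteristic roots inside the unit disc decays geometrically,
uniformly in the linear coefficient. -/
theorem exists_geometric_bound_of_recursion (s lam : ℝ) (hs : 2 ≤ s) (hlam0 : 0 ≤ lam)
    (hlam : lam < s + 1) :
    ∃ ρ C : ℝ, 3 / 4 ≤ ρ ∧ ρ < 1 ∧ 0 ≤ C ∧ ∀ θ : ℝ, |θ| ≤ lam → ∀ c : ℕ → ℝ,
      (∀ k, c (k + 2) = (θ * c (k + 1) - c k) / s) →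
      ∀ k, c k ^ 2 ≤ C * ρ ^ (2 * k) * (c 0 ^ 2 + c 1 ^ 2) := by
  -- The lower bound 3/4 makes `s * ρ ^ 2 ≥ 1`, hence `κ ≤ 1` below. The lower bound `lam / (s + 1)`
  -- makes `σ₀ < 1`.
  set ρ := max (3 / 4) (lam / (s + 1)) with hρdef
  have hρ1 : 3 / 4 ≤ ρ := le_max_left _ _
  have hρ2 : lam ≤ ρ * (s + 1) := (div_le_iff₀ (by linarith)).1 (le_max_right _ _)
  have hρ3 : ρ < 1 := max_lt (by norm_num) ((div_lt_one (by linarith)).2 hlam)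
  have hρ0 : 0 < ρ := by linarith
  have hden : 0 < s * ρ ^ 2 + 1 := by positivity
  have hnum : lam * ρ < s * ρ ^ 2 + 1 := by nlinarith
  set σ₀ := lam * ρ / (s * ρ ^ 2 + 1) with hσ₀
  have hσ1 : σ₀ < 1 := (div_lt_one hden).2 hnum
  have hσ0 : 0 ≤ σ₀ := by positivity
  refine ⟨ρ, 2 / (1 - σ₀) / ρ ^ 2, hρ1, hρ3, ?_, fun θ hθ c hc k => ?_⟩
  · have : 0 < 1 - σ₀ := by linarith
    positivity
  set κ := 1 / (s * ρ ^ 2) with hκ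
  have hκ0 : 0 < κ := by positivity
  have hκ1 : κ ≤ 1 := by
    rw [hκ, div_le_one (by positivity)]
    nlinarith
  set τ := θ / (s * ρ) with hτ
  set g : ℕ → ℝ := fun k => c k / ρ ^ k with hg
  have hrec : ∀ k, g (k + 2) = τ * g (k + 1) - κ * g k := by
    intro k
    simp only [hg, hτ, hκ, hc k]
    field_simp
    ring
  set σ := τ / (1 + κ) with hσ
  have hσeq : σ * (1 + κ) = τ := by rw [hσ]; field_simp
  have hσle : |σ| ≤ σ₀ := by
    have : σ = θ * ρ / (s * ρ ^ 2 + 1) := by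
      rw [hσ, hτ, hκ]; field_simp
    rw [this, hσ₀, abs_div, abs_mul, abs_of_pos hρ0, abs_of_pos hden]
    gcongr
  -- A Lyapunov function for the rescaled sequence `g`: the choice of `σ` makes its decrement a
  -- multiple of a square, and `|σ| ≤ σ₀ < 1` makes the form uniformly positive definite.
  set W : ℕ → ℝ := fun k => g (k + 1) ^ 2 + g k ^ 2 - 2 * σ * (g (k + 1) * g k) with hW
  have hWle : ∀ k, W (k + 1) ≤ W k := by
    intro k
    have h1 : W k - W (k + 1) = (1 - κ) * (1 + κ) * (σ * g (k + 1) - g k) ^ 2 := by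
      simp only [hW]
      rw [show k + 1 + 1 = k + 2 from rfl, hrec k, ← hσeq]
      ring
    have h2 : 0 ≤ (1 - κ) * (1 + κ) * (σ * g (k + 1) - g k) ^ 2 :=
      mul_nonneg (mul_nonneg (by linarith) (by linarith)) (sq_nonneg _)
    linarith
  have hW0 : ∀ k, W k ≤ W 0 := fun k => antitone_nat_of_succ_le hWle (Nat.zero_le k)
  have hab : ∀ a b : ℝ, |2 * σ * (a * b)| ≤ σ₀ * (a ^ 2 + b ^ 2) := by
    intro a b
    rw [abs_mul, abs_mul, abs_two]
    have h1 : 2 * |a * b| ≤ a ^ 2 + b ^ 2 := by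
      rw [abs_mul]
      nlinarith [sq_nonneg (|a| - |b|), sq_abs a, sq_abs b]
    nlinarith [abs_nonneg (a * b), abs_nonneg σ, sq_nonneg a, sq_nonneg b]
  have hlow : (1 - σ₀) * g k ^ 2 ≤ W k := by
    have := (abs_le.1 (hab (g (k + 1)) (g k))).2
    simp only [hW]
    nlinarith [sq_nonneg (g (k + 1))]
  have hup : W 0 ≤ 2 * (g 1 ^ 2 + g 0 ^ 2) := by
    have := (abs_le.1 (hab (g 1) (g 0))).1
    simp only [hW, zero_add]
    nlinarith [sq_nonneg (g 1), sq_nonneg (g 0)]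
  have hg0 : g 0 = c 0 := by simp [hg]
  have hg1 : g 1 = c 1 / ρ := by simp [hg]
  have hgk : c k = g k * ρ ^ k := by simp only [hg]; field_simp
  have h3 : (1 - σ₀) * g k ^ 2 ≤ 2 / ρ ^ 2 * (c 0 ^ 2 + c 1 ^ 2) := by
    have h4 : c 0 ^ 2 ≤ c 0 ^ 2 / ρ ^ 2 := by
      rw [le_div_iff₀ (by positivity)]
      exact mul_le_of_le_one_right (sq_nonneg _) (by nlinarith)
    calc (1 - σ₀) * g k ^ 2 ≤ 2 * (g 1 ^ 2 + g 0 ^ 2) := hlow.trans ((hW0 k).trans hup)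
      _ = 2 * (c 1 ^ 2 / ρ ^ 2 + c 0 ^ 2) := by rw [hg0, hg1, div_pow]
      _ ≤ 2 * (c 1 ^ 2 / ρ ^ 2 + c 0 ^ 2 / ρ ^ 2) := by gcongr
      _ = _ := by ring
  have h5 : g k ^ 2 ≤ 2 / (1 - σ₀) / ρ ^ 2 * (c 0 ^ 2 + c 1 ^ 2) := by
    have h6 : 0 < 1 - σ₀ := by linarith
    rw [mul_comm] at h3
    calc g k ^ 2 ≤ (2 / ρ ^ 2 * (c 0 ^ 2 + c 1 ^ 2)) / (1 - σ₀) := (le_div_iff₀ h6).2 h3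
      _ = _ := by ring
  calc c k ^ 2 = g k ^ 2 * ρ ^ (2 * k) := by rw [hgk, mul_pow, ← pow_mul, mul_comm k 2]
    _ ≤ (2 / (1 - σ₀) / ρ ^ 2 * (c 0 ^ 2 + c 1 ^ 2)) * ρ ^ (2 * k) := by gcongr
    _ = _ := by ring

set_option linter.unusedSectionVars false

/-! ### Spectral mixing of the non-backtracking walk -/

section Mixing

variable {V : Type*} [Fintype V] [DecidableEq V] (G : SimpleGraph V) [DecidableRel G.Adj]

/-- The probability that a non-backtracking walk on a `d`-regular graph which has just moved from
`p` to `x` is at `y` after `k` further steps. -/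
def nbHit (d : ℕ) (y : V) : ℕ → V → V → ℝ
  | 0, _, x => if x = y then 1 else 0
  | k + 1, p, x => (∑ z ∈ (G.neighborFinset x).erase p, nbHit d y k x z) / ((d : ℝ) - 1)

/-- The sum of `nbHit` over the `d` arcs that leave `x`. -/
def nbOut (d : ℕ) (y : V) (k : ℕ) (x : V) : ℝ :=
  ∑ z ∈ G.neighborFinset x, nbHit G d y k x z

variable {G} {d : ℕ}

theorem sum_sum_neighborFinset (hreg : G.IsRegularOfDegree d) (f : V → ℝ) :
    ∑ x, ∑ z ∈ G.neighborFinset x, f z = d * ∑ x, f x := by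
  have : ∀ x, ∑ z ∈ G.neighborFinset x, f z = ∑ z, if G.Adj x z then f z else 0 := by
    intro x
    rw [← Finset.sum_filter]
    congr 1
    ext z
    simp
  simp only [this]
  rw [Finset.sum_comm, Finset.mul_sum]
  refine Finset.sum_congr rfl fun z _ => ?_
  have : ∑ x, (if G.Adj x z then f z else 0) = ∑ x ∈ G.neighborFinset z, f z := by
    rw [← Finset.sum_filter]
    congr 1
    ext x
    simp [G.adj_comm]
  rw [this, Finset.sum_const, nsmul_eq_mul, G.card_neighborFinset_eq_degree, hreg z]

theorem card_erase_neighborFinset (hreg : G.IsRegularOfDegree d) (hd : 3 ≤ d) {p x : V}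
    (h : G.Adj x p) : (((G.neighborFinset x).erase p).card : ℝ) = (d : ℝ) - 1 := by
  rw [Finset.card_erase_of_mem (by simpa using h), G.card_neighborFinset_eq_degree, hreg x,
    Nat.cast_sub (by omega), Nat.cast_one]

theorem sum_erase_div_le (hreg : G.IsRegularOfDegree d) (hd : 3 ≤ d) {p x : V}
    (h : G.Adj x p) (f : V → ℝ) (b : ℝ) (hf : ∀ z ∈ (G.neighborFinset x).erase p, f z ≤ b) :
    (∑ z ∈ (G.neighborFinset x).erase p, f z) / ((d : ℝ) - 1) ≤ b := by
  have hd' : (3 : ℝ) ≤ d := by exact_mod_cast hd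
  rw [div_le_iff₀ (by linarith), ← card_erase_neighborFinset hreg hd h, mul_comm,
    ← nsmul_eq_mul]
  exact Finset.sum_le_card_nsmul _ _ _ hf

theorem adj_of_mem_erase {p x z : V} (hz : z ∈ (G.neighborFinset x).erase p) : G.Adj z x :=
  ((G.mem_neighborFinset x z).1 (Finset.mem_of_mem_erase hz)).symm

theorem nbHit_nonneg (hd : 3 ≤ d) (y : V) (k : ℕ) (p x : V) : 0 ≤ nbHit G d y k p x := by
  have hd' : (3 : ℝ) ≤ d := by exact_mod_cast hd
  induction k generalizing p x with
  | zero => simp only [nbHit]; split_ifs <;> norm_num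
  | succ k ih =>
    exact div_nonneg (Finset.sum_nonneg fun z _ => ih x z) (by linarith)

theorem nbHit_le_one (hreg : G.IsRegularOfDegree d) (hd : 3 ≤ d) (y : V) (k : ℕ) (p x : V)
    (h : G.Adj x p) : nbHit G d y k p x ≤ 1 := by
  induction k generalizing p x with
  | zero => simp only [nbHit]; split_ifs <;> norm_num
  | succ k ih => exact sum_erase_div_le hreg hd h _ _ fun z hz => ih x z (adj_of_mem_erase hz)

theorem nbHit_succ {y : V} {k : ℕ} {p x : V} (h : G.Adj x p) :
    nbHit G d y (k + 1) p x = (nbOut G d y k x - nbHit G d y k x p) / ((d : ℝ) - 1) := by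
  rw [nbHit, nbOut, ← Finset.add_sum_erase _ _ ((G.mem_neighborFinset x p).2 h)]
  ring

/-- Each arc out of `x` continues all but one of the `d` arcs into `x`, and this multiplicity `d -
1` cancels the normalisation. -/
theorem sum_nbHit_in (hreg : G.IsRegularOfDegree d) (hd : 3 ≤ d) (y : V) (k : ℕ) (x : V) :
    ∑ z ∈ G.neighborFinset x, nbHit G d y (k + 1) z x = nbOut G d y k x := by
  have hd' : (3 : ℝ) ≤ d := by exact_mod_cast hd
  have : ∀ z ∈ G.neighborFinset x, nbHit G d y (k + 1) z x
      = (nbOut G d y k x - nbHit G d y k x z) / ((d : ℝ) - 1) := fun z hz =>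
    nbHit_succ ((G.mem_neighborFinset x z).1 hz)
  rw [Finset.sum_congr rfl this, ← Finset.sum_div, Finset.sum_sub_distrib, Finset.sum_const,
    G.card_neighborFinset_eq_degree, hreg x, nsmul_eq_mul, ← nbOut,
    div_eq_iff (by linarith)]
  ring

theorem nbOut_succ (y : V) (k : ℕ) (x : V) :
    nbOut G d y (k + 1) x = (∑ z ∈ G.neighborFinset x, nbOut G d y k z
      - ∑ z ∈ G.neighborFinset x, nbHit G d y k z x) / ((d : ℝ) - 1) := by
  have : ∀ z ∈ G.neighborFinset x, nbHit G d y (k + 1) x z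
      = (nbOut G d y k z - nbHit G d y k z x) / ((d : ℝ) - 1) := fun z hz =>
    nbHit_succ ((G.mem_neighborFinset x z).1 hz).symm
  rw [nbOut, Finset.sum_congr rfl this, ← Finset.sum_div, Finset.sum_sub_distrib]

/-- Arcs are eliminated here: the recursion involves only functions on vertices and the adjacency
operator, so the symmetric eigenbasis can be used although the walk on arcs is not reversible. -/
theorem nbOut_add_two (hreg : G.IsRegularOfDegree d) (hd : 3 ≤ d) (y : V) (k : ℕ) (x : V) :
    nbOut G d y (k + 2) x = (∑ z ∈ G.neighborFinset x, nbOut G d y (k + 1) z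
      - nbOut G d y k x) / ((d : ℝ) - 1) := by
  rw [nbOut_succ, sum_nbHit_in hreg hd]

/-- Conservation of mass. It makes the centred function orthogonal to the constants at all times;
the recursion has order two, hence the two base cases. -/
theorem sum_nbOut (hreg : G.IsRegularOfDegree d) (hd : 3 ≤ d) (y : V) :
    ∀ k, ∑ x, nbOut G d y k x = d
  | 0 => by
    simp only [nbOut, nbHit]
    rw [sum_sum_neighborFinset hreg]
    simp
  | 1 => by
    have hd' : (3 : ℝ) ≤ d := by exact_mod_cast hd
    simp only [nbOut_succ]
    rw [← Finset.sum_div, Finset.sum_sub_distrib, sum_sum_neighborFinset hreg,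
      sum_nbOut hreg hd y 0, div_eq_iff (by linarith)]
    have : ∑ x, ∑ z ∈ G.neighborFinset x, nbHit G d y 0 z x = d := by
      simp only [nbHit, Finset.sum_const, G.card_neighborFinset_eq_degree, hreg.degree_eq,
        nsmul_eq_mul]
      rw [← Finset.mul_sum]
      simp
    rw [this]
    ring
  | k + 2 => by
    have hd' : (3 : ℝ) ≤ d := by exact_mod_cast hd
    simp only [nbOut_add_two hreg hd]
    rw [← Finset.sum_div, Finset.sum_sub_distrib, sum_sum_neighborFinset hreg,
      sum_nbOut hreg hd y (k + 1), sum_nbOut hreg hd y k, div_eq_iff (by linarith)]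
    ring

theorem abs_nbOut_sub_le (hreg : G.IsRegularOfDegree d) (hd : 3 ≤ d) (y : V) (k : ℕ) (x : V) :
    |nbOut G d y k x - d / Fintype.card V| ≤ d := by
  have hn : (1 : ℝ) ≤ Fintype.card V := by
    exact_mod_cast Fintype.card_pos_iff.2 ⟨x⟩
  have h0 : 0 ≤ nbOut G d y k x := Finset.sum_nonneg fun z _ => nbHit_nonneg hd y k x z
  have h1 : nbOut G d y k x ≤ d := by
    have := Finset.sum_le_card_nsmul (G.neighborFinset x) (fun z => nbHit G d y k x z) 1
      fun z hz => nbHit_le_one hreg hd y k x z ((G.mem_neighborFinset x z).1 hz).symm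
    rwa [G.card_neighborFinset_eq_degree, hreg x, nsmul_eq_mul, mul_one] at this
  have h2 : 0 ≤ (d : ℝ) / Fintype.card V := by positivity
  have h3 : (d : ℝ) / Fintype.card V ≤ d := div_le_self (by positivity) hn
  rw [abs_le]
  constructor <;> linarith

/-- The coefficient of `f` along the `i`-th adjacency eigenvector. -/
def adjCoeff (G : SimpleGraph V) [DecidableRel G.Adj] (f : V → ℝ) (i : V) : ℝ :=
  ∑ x, (adjMatrix_real_isHermitian G).eigenvectorBasis i x * f x

theorem sum_adjCoeff_sq (f : V → ℝ) : ∑ i, adjCoeff G f i ^ 2 = ∑ x, f x ^ 2 := by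
  have h := (adjMatrix_real_isHermitian G).eigenvectorBasis.sum_sq_norm_inner_right
    (WithLp.toLp 2 f)
  rw [EuclideanSpace.norm_sq_eq] at h
  simp only [Real.norm_eq_abs, sq_abs] at h
  rw [← h]
  refine Finset.sum_congr rfl fun i _ => ?_
  simp [adjCoeff, PiLp.inner_apply, mul_comm]

theorem adjCoeff_neighborSum (f : V → ℝ) (i : V) :
    adjCoeff G (fun x => ∑ z ∈ G.neighborFinset x, f z) i
      = (adjMatrix_real_isHermitian G).eigenvalues i * adjCoeff G f i := by
  have hv := (adjMatrix_real_isHermitian G).mulVec_eigenvectorBasis i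
  simp only [adjCoeff]
  have h1 : ∀ x, ∑ z ∈ G.neighborFinset x, f z = ∑ z, G.adjMatrix ℝ x z * f z := by
    intro x
    simp only [SimpleGraph.adjMatrix_apply, ite_mul, one_mul, zero_mul]
    rw [← Finset.sum_filter]
    congr 1
    ext z
    simp
  simp only [h1, Finset.mul_sum]
  rw [Finset.sum_comm]
  refine Finset.sum_congr rfl fun z _ => ?_
  have h2 := congrFun hv z
  simp only [Matrix.mulVec, dotProduct, Pi.smul_apply, smul_eq_mul] at h2
  rw [← mul_assoc, ← h2, Finset.sum_mul]
  refine Finset.sum_congr rfl fun x _ => ?_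
  have : G.adjMatrix ℝ x z = G.adjMatrix ℝ z x := by
    simp [SimpleGraph.adjMatrix_apply, G.adj_comm]
  rw [this]
  ring

/-- Only the eigenvector of index 0 can have a large eigenvalue. The constant function has
eigenvalue `d`, above all the others in absolute value, so it is orthogonal to the other
eigenvectors and spans the line of the first. A function of zero sum therefore has no component
there. -/
theorem adjCoeff_eq_zero_or_abs_le {n : ℕ} {lam : ℝ} (hG : IsNDLambdaGraph G n d lam)
    (hlam : lam < d) (f : V → ℝ) (hf : ∑ x, f x = 0) (i : V) :
    adjCoeff G f i = 0 ∨ |(adjMatrix_real_isHermitian G).eigenvalues i| ≤ lam := by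
  classical
  have hle : ∀ j : V, 0 < ((Fintype.equivOfCardEq (Fintype.card_fin (Fintype.card V))).symm j : Fin (Fintype.card V)).val →
      |(adjMatrix_real_isHermitian G).eigenvalues j| ≤ lam := fun j hj =>
    hG.isGreatest.2 ⟨_, hj, rfl⟩
  by_cases hi : 0 < ((Fintype.equivOfCardEq (Fintype.card_fin (Fintype.card V))).symm i : Fin (Fintype.card V)).val
  · exact Or.inr (hle i hi)
  left
  have hone : ∀ j, j ≠ i → adjCoeff G (fun _ => 1) j = 0 := by
    intro j hj
    have hj' : 0 < ((Fintype.equivOfCardEq (Fintype.card_fin (Fintype.card V))).symm j : Fin (Fintype.card V)).val := by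
      by_contra h0
      apply hj
      apply (Fintype.equivOfCardEq (Fintype.card_fin (Fintype.card V))).symm.injective
      apply Fin.ext
      omega
    have h1 := adjCoeff_neighborSum (G := G) (fun _ => 1) j
    simp only [Finset.sum_const, G.card_neighborFinset_eq_degree, hG.regular.degree_eq,
      nsmul_eq_mul, mul_one] at h1
    have h2 : adjCoeff G (fun _ => (d : ℝ)) j = d * adjCoeff G (fun _ => 1) j := by
      simp [adjCoeff, Finset.mul_sum, mul_comm]
    rw [h2] at h1
    have h3 := (le_abs_self _).trans (hle j hj')
    have h4 : ((d : ℝ) - (adjMatrix_real_isHermitian G).eigenvalues j)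
        * adjCoeff G (fun _ => 1) j = 0 := by linarith
    rcases mul_eq_zero.1 h4 with h | h
    · linarith
    · exact h
  have hpar : ∑ j, adjCoeff G (fun _ => 1) j * adjCoeff G f j = 0 := by
    have e1 := sum_adjCoeff_sq (G := G) (fun x => 1 + f x)
    have e2 := sum_adjCoeff_sq (G := G) (fun _ => (1 : ℝ))
    have e3 := sum_adjCoeff_sq (G := G) f
    have e4 : ∀ j, adjCoeff G (fun x => 1 + f x) j
        = adjCoeff G (fun _ => 1) j + adjCoeff G f j := by
      intro j
      simp [adjCoeff, mul_add, Finset.sum_add_distrib]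
    simp only [e4, add_sq, Finset.sum_add_distrib, e2, e3] at e1
    simp only [mul_assoc, ← Finset.mul_sum, one_mul, hf] at e1
    linarith
  rw [Finset.sum_eq_single i (fun j _ hj => by rw [hone j hj, zero_mul])
    (fun h => absurd (Finset.mem_univ i) h)] at hpar
  rcases mul_eq_zero.1 hpar with h | h
  · exfalso
    have e2 := sum_adjCoeff_sq (G := G) (fun _ => (1 : ℝ))
    rw [Finset.sum_eq_single i (fun j _ hj => by rw [hone j hj]; norm_num)
      (fun h => absurd (Finset.mem_univ i) h), h] at e2
    have hn : 0 < Fintype.card V := Fintype.card_pos_iff.2 ⟨i⟩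
    rw [Finset.sum_const, Finset.card_univ, one_pow, nsmul_eq_mul, mul_one,
      zero_pow two_ne_zero] at e2
    exact hn.ne (by exact_mod_cast e2)
  · exact h

/-- **Mixing.** The position of a non-backtracking walk on an expander is nearly uniform after a
number of steps that is logarithmic in the number of vertices. -/
theorem exists_nbHit_mixing (d : ℕ) (hd : 3 ≤ d) (lam : ℝ) (hlam : lam < d) :
    ∃ ρ K : ℝ, 0 < ρ ∧ ρ < 1 ∧ 0 < K ∧
      ∀ (V : Type*) [Fintype V] [DecidableEq V] (G : SimpleGraph V) [DecidableRel G.Adj]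
        (n : ℕ) (lamG : ℝ), IsNDLambdaGraph G n d lamG → lamG ≤ lam →
      ∀ (y : V) (k : ℕ) (p x : V), G.Adj x p →
        |nbHit G d y k p x - 1 / n| ≤ K * n * ρ ^ k := by
  have hd' : (3 : ℝ) ≤ d := by exact_mod_cast hd
  obtain ⟨ρ, C, hρ1, hρ2, hC, hrec⟩ := exists_geometric_bound_of_recursion ((d : ℝ) - 1)
    (max lam 0) (by linarith) (le_max_right _ _) (max_lt (by linarith) (by linarith))
  have hρ0 : 0 < ρ := by linarith
  set D : ℝ := (C * 2 + 1) * d with hD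
  have hD1 : 1 ≤ D := by nlinarith
  refine ⟨ρ, 4 * D, hρ0, hρ2, by linarith, ?_⟩
  intro V _ _ G _ n lamG hG hle y k p x hxp
  have hcard : (Fintype.card V : ℝ) = n := by exact_mod_cast hG.card_eq
  have hn : (1 : ℝ) ≤ n := by
    rw [← hcard]
    exact_mod_cast Fintype.card_pos_iff.2 ⟨x⟩
  have hreg := hG.regular
  -- Parseval is used in both directions around the scalar recursion. Bounding a value by the ℓ²
  -- norm costs a power of `n`, which a logarithmic number of steps repays.
  have hout : ∀ k x, |nbOut G d y k x - d / n| ≤ D * n * ρ ^ k := by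
    intro k x
    set f : ℕ → V → ℝ := fun k x => nbOut G d y k x - d / n with hf
    have hsum : ∀ k, ∑ x, f k x = 0 := by
      intro k
      simp only [hf, Finset.sum_sub_distrib, sum_nbOut hreg hd, Finset.sum_const,
        Finset.card_univ, nsmul_eq_mul, hcard]
      field_simp
      ring
    have hfrec : ∀ k x, f (k + 2) x
        = (∑ z ∈ G.neighborFinset x, f (k + 1) z - f k x) / ((d : ℝ) - 1) := by
      intro k x
      simp only [hf, nbOut_add_two hreg hd, Finset.sum_sub_distrib, Finset.sum_const,
        G.card_neighborFinset_eq_degree, hreg.degree_eq, nsmul_eq_mul]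
      have : (d : ℝ) - 1 ≠ 0 := by linarith
      field_simp
      ring
    have hcrec : ∀ i k, adjCoeff G (f (k + 2)) i
        = ((adjMatrix_real_isHermitian G).eigenvalues i * adjCoeff G (f (k + 1)) i
          - adjCoeff G (f k) i) / ((d : ℝ) - 1) := by
      intro i k
      rw [← adjCoeff_neighborSum]
      simp only [adjCoeff, hfrec]
      rw [← Finset.sum_sub_distrib, Finset.sum_div]
      refine Finset.sum_congr rfl fun x _ => ?_
      ring
    have hci : ∀ i, adjCoeff G (f k) i ^ 2
        ≤ C * ρ ^ (2 * k) * (adjCoeff G (f 0) i ^ 2 + adjCoeff G (f 1) i ^ 2) := by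
      intro i
      rcases adjCoeff_eq_zero_or_abs_le hG (hle.trans_lt hlam) (f k) (hsum k) i with h | h
      · rw [h, zero_pow two_ne_zero]
        positivity
      · exact hrec _ ((h.trans hle).trans (le_max_left _ _)) (fun k => adjCoeff G (f k) i)
          (hcrec i) k
    have hf2 : ∀ k, ∑ x, f k x ^ 2 ≤ n * (d : ℝ) ^ 2 := by
      intro k
      have := Finset.sum_le_card_nsmul Finset.univ (fun x => f k x ^ 2) ((d : ℝ) ^ 2)
        fun x _ => by
          have := abs_nbOut_sub_le hreg hd y k x
          rw [hcard] at this
          exact sq_le_sq' (by linarith [(abs_le.1 this).1]) (abs_le.1 this).2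
      rwa [Finset.card_univ, nsmul_eq_mul, hcard] at this
    have h1 : f k x ^ 2 ≤ C * ρ ^ (2 * k) * (n * (d : ℝ) ^ 2 + n * (d : ℝ) ^ 2) := by
      calc f k x ^ 2 ≤ ∑ x, f k x ^ 2 :=
            Finset.single_le_sum (fun x _ => sq_nonneg (f k x)) (Finset.mem_univ x)
        _ = ∑ i, adjCoeff G (f k) i ^ 2 := (sum_adjCoeff_sq _).symm
        _ ≤ ∑ i, C * ρ ^ (2 * k) * (adjCoeff G (f 0) i ^ 2 + adjCoeff G (f 1) i ^ 2) :=
            Finset.sum_le_sum fun i _ => hci i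
        _ = C * ρ ^ (2 * k) * (∑ x, f 0 x ^ 2 + ∑ x, f 1 x ^ 2) := by
            rw [← Finset.mul_sum, Finset.sum_add_distrib, sum_adjCoeff_sq, sum_adjCoeff_sq]
        _ ≤ _ := by gcongr <;> exact hf2 _
    refine abs_le_of_sq_le_sq (h1.trans ?_) (by positivity)
    have h2 : (D * n * ρ ^ k) ^ 2 = ρ ^ (2 * k) * (n * n) * ((C * 2 + 1) ^ 2 * (d : ℝ) ^ 2) := by
      rw [hD]; ring
    have h3 : C * ρ ^ (2 * k) * (n * (d : ℝ) ^ 2 + n * (d : ℝ) ^ 2)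
        = ρ ^ (2 * k) * (n * 1) * (C * 2 * (d : ℝ) ^ 2) := by ring
    rw [h2, h3]
    have h4 : C * 2 ≤ (C * 2 + 1) ^ 2 := by nlinarith
    gcongr
  -- Return from vertices to arcs. The constant `4 * D` reproduces itself because `D + 4 * D ≤ 4 * D
  -- * ρ * (d - 1)`, as `ρ ≥ 3 / 4` and `d - 1 ≥ 2`.
  induction k generalizing p x with
  | zero =>
    have h0 : nbHit G d y 0 p x ≤ 1 := nbHit_le_one hreg hd y 0 p x hxp
    have h1 : 0 ≤ nbHit G d y 0 p x := nbHit_nonneg hd y 0 p x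
    have h2 : (1 : ℝ) / n ≤ 1 := (div_le_one (by linarith)).2 hn
    have h3 : (0 : ℝ) ≤ 1 / n := by positivity
    rw [pow_zero, mul_one, abs_le]
    constructor <;> nlinarith
  | succ k ih =>
    have h1 := hout k x
    have h2 := ih x p hxp.symm
    have h3 : nbHit G d y (k + 1) p x - 1 / n
        = ((nbOut G d y k x - d / n) - (nbHit G d y k x p - 1 / n)) / ((d : ℝ) - 1) := by
      rw [nbHit_succ hxp]
      have : (d : ℝ) - 1 ≠ 0 := by linarith
      field_simp
      ring
    have hB : 0 ≤ D * n * ρ ^ k := by positivity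
    rw [h3, abs_div, abs_of_pos (show (0 : ℝ) < (d : ℝ) - 1 by linarith),
      div_le_iff₀ (by linarith)]
    have h4 : |(nbOut G d y k x - d / n) - (nbHit G d y k x p - 1 / n)|
        ≤ D * n * ρ ^ k + 4 * D * n * ρ ^ k := (abs_sub _ _).trans (add_le_add h1 h2)
    have h5 : 4 * D * n * ρ ^ (k + 1) * ((d : ℝ) - 1)
        = (D * n * ρ ^ k) * (4 * ρ * ((d : ℝ) - 1)) := by ring
    rw [h5]
    nlinarith [mul_nonneg hB (show (0 : ℝ) ≤ 4 * ρ * ((d : ℝ) - 1) - 5 by nlinarith)]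

end Mixing

/-! ### Large girth and short-time hitting probabilities -/

section Girth

/-- In a graph of large girth, short non-backtracking walks are determined by their ends. -/
theorem edges_eq_of_isChain_of_girth {V : Type*} {G : SimpleGraph V} {x y : V} (p q : G.Walk x y)
    (hp : List.IsChain (· ≠ ·) p.edges) (hq : List.IsChain (· ≠ ·) q.edges)
    (hlen : p.length + q.length < G.girth) : p.IsPath ∧ p.edges = q.edges := by
  classical
  -- A cycle made of edges of the two walks would be shorter than the girth, so these edges form a
  -- forest. There, non-backtracking walks are paths, and paths are determined by their ends.
  set H : SimpleGraph V := SimpleGraph.fromEdgeSet {e | e ∈ p.edges ∨ e ∈ q.edges} with hH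
  have hHG : H ≤ G := by
    rw [← SimpleGraph.edgeSet_subset_edgeSet, hH, SimpleGraph.edgeSet_fromEdgeSet]
    rintro e ⟨he | he, -⟩
    · exact p.edges_subset_edgeSet he
    · exact q.edges_subset_edgeSet he
  have hmem : ∀ e ∈ G.edgeSet, (e ∈ p.edges ∨ e ∈ q.edges) → e ∈ H.edgeSet := by
    intro e heG he
    rw [hH, SimpleGraph.edgeSet_fromEdgeSet]
    exact ⟨he, G.not_isDiag_of_mem_edgeSet heG⟩
  have hpH : ∀ e ∈ p.edges, e ∈ H.edgeSet := fun e he =>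
    hmem e (p.edges_subset_edgeSet he) (Or.inl he)
  have hqH : ∀ e ∈ q.edges, e ∈ H.edgeSet := fun e he =>
    hmem e (q.edges_subset_edgeSet he) (Or.inr he)
  have hac : H.IsAcyclic := by
    intro v c hc
    have h1 : (c.map (SimpleGraph.Hom.ofLE hHG)).IsCycle :=
      hc.map Function.injective_id
    have h2 := SimpleGraph.girth_le_length h1
    rw [SimpleGraph.Walk.length_map] at h2
    have h3 : c.edges ⊆ p.edges ++ q.edges := by
      intro e he
      have := c.edges_subset_edgeSet he
      rw [hH, SimpleGraph.edgeSet_fromEdgeSet] at this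
      exact List.mem_append.2 this.1
    have h4 := (hc.isTrail.edges_nodup.subperm h3).length_le
    rw [List.length_append, SimpleGraph.Walk.length_edges, SimpleGraph.Walk.length_edges,
      SimpleGraph.Walk.length_edges] at h4
    omega
  have hp' : (p.transfer H hpH).IsPath := by
    rw [hac.isPath_iff_isChain, SimpleGraph.Walk.edges_transfer]
    exact hp
  have hq' : (q.transfer H hqH).IsPath := by
    rw [hac.isPath_iff_isChain, SimpleGraph.Walk.edges_transfer]
    exact hq
  have heq := congrArg (fun r : H.Path x y => r.1.edges)
    ((hac.subsingleton_path x y).elim ⟨_, hp'⟩ ⟨_, hq'⟩)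
  simp only [SimpleGraph.Walk.edges_transfer] at heq
  refine ⟨?_, heq⟩
  rw [SimpleGraph.Walk.isPath_def] at hp' ⊢
  rwa [SimpleGraph.Walk.support_transfer] at hp'

variable {V : Type*} [Fintype V] [DecidableEq V] {G : SimpleGraph V} [DecidableRel G.Adj]
  {d : ℕ}

/-- A non-backtracking walk that goes from `x` to `y` in `k` steps with a positive probability. -/
theorem exists_walk_of_nbHit_ne_zero (y : V) (k : ℕ) (p x : V) (hxp : G.Adj x p)
    (h : nbHit G d y k p x ≠ 0) :
    ∃ w : G.Walk x y, w.length = k ∧ List.IsChain (· ≠ ·) (s(p, x) :: w.edges) := by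
  induction k generalizing p x with
  | zero =>
    simp only [nbHit, ne_eq, ite_eq_right_iff, one_ne_zero, imp_false, not_not] at h
    subst h
    exact ⟨.nil, rfl, by simp⟩
  | succ k ih =>
    rw [nbHit] at h
    have h1 : ∑ z ∈ (G.neighborFinset x).erase p, nbHit G d y k x z ≠ 0 := fun h0 =>
      h (by rw [h0, zero_div])
    obtain ⟨z, hz, hz0⟩ := Finset.exists_ne_zero_of_sum_ne_zero h1
    obtain ⟨w, hw, hc⟩ := ih x z (adj_of_mem_erase hz) hz0
    refine ⟨.cons (adj_of_mem_erase hz).symm w, by simp [hw], ?_⟩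
    rw [SimpleGraph.Walk.edges_cons, List.isChain_cons_cons]
    refine ⟨fun he => ?_, hc⟩
    rcases Sym2.eq_iff.1 he with ⟨rfl, -⟩ | ⟨rfl, -⟩
    · exact hxp.ne rfl
    · exact Finset.ne_of_mem_erase hz rfl

/-- At each step at most one of the `d - 1` choices can still lead to `y` in time: two such choices
would give distinct non-backtracking walks with the same ends and total length at most `2 * h`. -/
theorem nbHit_le_of_girth (hd : 3 ≤ d) {h : ℕ} (hg : 2 * h < G.girth) (y : V) (k : ℕ)
    (hk : k ≤ h) (p x : V) (hxp : G.Adj x p) :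
    nbHit G d y k p x ≤ (1 / ((d : ℝ) - 1)) ^ k := by
  have hd' : (3 : ℝ) ≤ d := by exact_mod_cast hd
  have hd1 : (0 : ℝ) < (d : ℝ) - 1 := by linarith
  induction k generalizing p x with
  | zero =>
    simp only [nbHit, pow_zero]
    split_ifs <;> norm_num
  | succ k ih =>
    by_cases h0 : ∃ z ∈ (G.neighborFinset x).erase p, nbHit G d y k x z ≠ 0
    · obtain ⟨z, hz, hz0⟩ := h0
      have huniq : ∀ z' ∈ (G.neighborFinset x).erase p, z' ≠ z → nbHit G d y k x z' = 0 := by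
        intro z' hz' hne
        by_contra hz0'
        obtain ⟨w, hw, hc⟩ := exists_walk_of_nbHit_ne_zero y k x z (adj_of_mem_erase hz) hz0
        obtain ⟨w', hw', hc'⟩ :=
          exists_walk_of_nbHit_ne_zero y k x z' (adj_of_mem_erase hz') hz0'
        have := (edges_eq_of_isChain_of_girth (.cons (adj_of_mem_erase hz).symm w)
          (.cons (adj_of_mem_erase hz').symm w') hc hc' (by simp [hw, hw']; omega)).2
        simp only [SimpleGraph.Walk.edges_cons, List.cons.injEq, Sym2.congr_right] at this
        exact hne this.1.symm
      rw [nbHit, Finset.sum_eq_single_of_mem z hz huniq, pow_succ, mul_one_div]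
      gcongr
      exact ih (by omega) x z (adj_of_mem_erase hz)
    · push Not at h0
      rw [nbHit, Finset.sum_eq_zero h0, zero_div]
      positivity

/-- A hitting probability at a later time is an average of hitting probabilities at time `h`, so the
bound persists. -/
theorem nbHit_le_of_le_of_girth (hreg : G.IsRegularOfDegree d) (hd : 3 ≤ d) {h : ℕ}
    (hg : 2 * h < G.girth) (y : V) (k : ℕ) (hk : h ≤ k) (p x : V) (hxp : G.Adj x p) :
    nbHit G d y k p x ≤ (1 / ((d : ℝ) - 1)) ^ h := by
  induction k, hk using Nat.le_induction generalizing p x with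
  | base => exact nbHit_le_of_girth hd hg y h le_rfl p x hxp
  | succ k _ ih => exact sum_erase_div_le hreg hd hxp _ _ fun z hz => ih x z (adj_of_mem_erase hz)

/-- The vertices `x` and `y` are joined by a walk of fewer than `h` steps. -/
def IsNear {V : Type*} (G : SimpleGraph V) (h : ℕ) (x y : V) : Prop := ∃ w : G.Walk x y, w.length < h

theorem IsNear.symm {V : Type*} {G : SimpleGraph V} {h : ℕ} {x y : V} (hxy : IsNear G h x y) : IsNear G h y x := by
  obtain ⟨w, hw⟩ := hxy
  exact ⟨w.reverse, by simpa using hw⟩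

/-- Times below `h` contribute nothing: a far vertex is out of reach, and a return to `x` itself
would be a short closed non-backtracking walk. The bound is thus valid from the first step on. -/
theorem nbHit_le_of_not_isNear (hreg : G.IsRegularOfDegree d) (hd : 3 ≤ d) {h : ℕ}
    (hg : 2 * h < G.girth) {y x : V} (hxy : x = y ∨ ¬ IsNear G h x y) (k : ℕ) (hk : 1 ≤ k)
    (p : V) (hxp : G.Adj x p) : nbHit G d y k p x ≤ (1 / ((d : ℝ) - 1)) ^ h := by
  have hd' : (3 : ℝ) ≤ d := by exact_mod_cast hd
  have hd1 : (0 : ℝ) < (d : ℝ) - 1 := by linarith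
  rcases le_or_gt h k with hhk | hkh
  · exact nbHit_le_of_le_of_girth hreg hd hg y k hhk p x hxp
  have h0 : nbHit G d y k p x = 0 := by
    by_contra hne
    obtain ⟨w, hw, hc⟩ := exists_walk_of_nbHit_ne_zero y k p x hxp hne
    rcases hxy with rfl | hfar
    · have := (edges_eq_of_isChain_of_girth w .nil (List.isChain_cons.1 hc).2 (by simp)
        (by simp [hw]; omega)).2
      have hl := congrArg List.length this
      rw [SimpleGraph.Walk.length_edges, hw] at hl
      simp at hl
      omega
    · exact hfar ⟨w, by omega⟩
  rw [h0]
  positivity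

open Classical in
theorem card_isNear_le (hreg : G.IsRegularOfDegree d) (hd : 3 ≤ d) (h : ℕ) (x : V) :
    (Finset.univ.filter fun y => IsNear G h x y).card ≤ d ^ h := by
  -- The form `2 * d ^ h - 1` is stable under the step `a ↦ 1 + a * d` because `d ≥ 2`, whereas `d ^
  -- h` is not.
  have key : ∀ h, (Finset.univ.filter fun y => ∃ w : G.Walk x y, w.length ≤ h).card
      ≤ 2 * d ^ h - 1 := by
    intro h
    induction h with
    | zero =>
      have : (Finset.univ.filter fun y => ∃ w : G.Walk x y, w.length ≤ 0) ⊆ {x} := by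
        intro y hy
        obtain ⟨w, hw⟩ := (Finset.mem_filter.1 hy).2
        rw [Finset.mem_singleton]
        exact (SimpleGraph.Walk.eq_of_length_eq_zero (Nat.le_zero.1 hw)).symm
      simpa using Finset.card_le_card this
    | succ h ih =>
      set S := Finset.univ.filter fun y => ∃ w : G.Walk x y, w.length ≤ h with hS
      have hsub : (Finset.univ.filter fun y => ∃ w : G.Walk x y, w.length ≤ h + 1)
          ⊆ insert x (S.biUnion fun z => G.neighborFinset z) := by
        intro y hy
        obtain ⟨w, hw⟩ := (Finset.mem_filter.1 hy).2
        rw [Finset.mem_insert, Finset.mem_biUnion]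
        by_cases hn : w.Nil
        · exact Or.inl hn.eq.symm
        · refine Or.inr ⟨w.penultimate, ?_, ?_⟩
          · rw [hS, Finset.mem_filter]
            refine ⟨Finset.mem_univ _, w.dropLast, ?_⟩
            have := SimpleGraph.Walk.length_dropLast_add_one hn
            omega
          · rw [SimpleGraph.mem_neighborFinset]
            exact w.adj_penultimate hn
      have h1 := Finset.card_le_card hsub
      have h2 := Finset.card_insert_le x (S.biUnion fun z => G.neighborFinset z)
      have h3 : (S.biUnion fun z => G.neighborFinset z).card ≤ S.card * d :=
        Finset.card_biUnion_le_card_mul _ _ _ fun z _ => by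
          rw [G.card_neighborFinset_eq_degree, hreg z]
      have h4 : S.card * d ≤ (2 * d ^ h - 1) * d := Nat.mul_le_mul_right d ih
      have h5 : (2 * d ^ h - 1) * d = 2 * d ^ (h + 1) - d := by
        rw [Nat.sub_mul, pow_succ, one_mul, mul_assoc]
      have h6 : d ≤ d ^ (h + 1) := Nat.le_self_pow (by omega) d
      omega
  rcases h with - | h
  · simp [IsNear]
  · have : ∀ y, IsNear G (h + 1) x y ↔ ∃ w : G.Walk x y, w.length ≤ h := fun y =>
      exists_congr fun w => Nat.lt_succ_iff
    simp only [this]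
    have h1 := key h
    have h2 : 2 * d ^ h ≤ d ^ (h + 1) := by
      rw [pow_succ, mul_comm]
      exact Nat.mul_le_mul_left _ (by omega)
    omega

end Girth

/-! ### Expectations: from the path measure to a recursion on arcs -/

section Expectation

variable {V : Type*} [Fintype V] [DecidableEq V] (G : SimpleGraph V) [DecidableRel G.Adj]

/-- The expectation of `Φ` over the non-backtracking random walk of length `k` from `w₀`. -/
def nbExp (w₀ : V) (k : ℕ) (Φ : (Fin (k + 1) → V) → ℝ) : ℝ :=
  ∑ w, nbWalkProb G w₀ k w * Φ w

/-- The vertices to which the walk `w` may be extended. -/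
def nbNext {k : ℕ} (w : Fin (k + 1) → V) : Finset V :=
  nbChoices G (Fin.snoc (α := fun _ => V) w (w 0) : Fin (k + 2) → V) (Fin.last k)

/-- The expectation of `Φ (X_u, X_v)` over `k` further steps of a non-backtracking walk on a
`d`-regular graph which has just moved from `p` to `x`, where `X_u` and `X_v` count the visits
to `u` and `v`. -/
def nbVisitExp (d : ℕ) (u v : V) : ℕ → V → V → (ℕ → ℕ → ℝ) → ℝ
  | 0, _, _, Φ => Φ 0 0
  | k + 1, p, x, Φ => (∑ z ∈ (G.neighborFinset x).erase p, nbVisitExp d u v k x z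
      fun a b => Φ (a + if z = u then 1 else 0) (b + if z = v then 1 else 0)) / ((d : ℝ) - 1)

variable {G} {d : ℕ}

theorem nbWalkProb_nonneg (w₀ : V) (k : ℕ) (w : Fin (k + 1) → V) : 0 ≤ nbWalkProb G w₀ k w := by
  unfold nbWalkProb
  refine mul_nonneg (by split_ifs <;> norm_num) (Finset.prod_nonneg fun i _ => ?_)
  split_ifs <;> positivity

theorem nbWalkProb_snoc (w₀ : V) (k : ℕ) (w : Fin (k + 1) → V) (z : V) :
    nbWalkProb G w₀ (k + 1) (Fin.snoc (α := fun _ => V) w z)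
      = nbWalkProb G w₀ k w * (if z ∈ nbNext G w then ((nbNext G w).card : ℝ)⁻¹ else 0) := by
  unfold nbWalkProb nbNext
  rw [Fin.prod_univ_castSucc, nbChoices_snoc_last G w z (w 0), Fin.succ_last, Fin.snoc_last,
    ← mul_assoc]
  have h0 : (Fin.snoc (α := fun _ => V) w z : Fin (k + 2) → V) 0 = w 0 :=
    Fin.snoc_castSucc (α := fun _ => V) z w 0
  rw [h0]
  congr 2
  refine Finset.prod_congr rfl fun i _ => ?_
  rw [nbChoices_snoc_castSucc, Fin.succ_castSucc, Fin.snoc_castSucc]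

theorem nbExp_succ (w₀ : V) (k : ℕ) (Φ : (Fin (k + 2) → V) → ℝ) :
    nbExp G w₀ (k + 1) Φ = nbExp G w₀ k fun w =>
      (∑ z ∈ nbNext G w, Φ (Fin.snoc (α := fun _ => V) w z)) / (nbNext G w).card := by
  unfold nbExp
  rw [← (Fin.snocEquiv fun _ : Fin (k + 2) => V).sum_comp, Fintype.sum_prod_type_right]
  refine Finset.sum_congr rfl fun w _ => ?_
  have : ∀ z : V, (Fin.snocEquiv fun _ : Fin (k + 2) => V) (z, w)
      = Fin.snoc (α := fun _ => V) w z := fun _ => rfl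
  simp only [this, nbWalkProb_snoc]
  rw [div_eq_mul_inv, Finset.sum_mul, Finset.mul_sum]
  rw [← Finset.sum_filter_add_sum_filter_not Finset.univ (fun z => z ∈ nbNext G w)]
  have h2 : ∑ z ∈ Finset.univ.filter (fun z => ¬ z ∈ nbNext G w), nbWalkProb G w₀ k w *
      (if z ∈ nbNext G w then ((nbNext G w).card : ℝ)⁻¹ else 0) *
        Φ (Fin.snoc (α := fun _ => V) w z) = 0 := by
    refine Finset.sum_eq_zero fun z hz => ?_
    rw [if_neg (Finset.mem_filter.1 hz).2]
    ring
  rw [h2, add_zero, Finset.filter_mem_eq_inter, Finset.univ_inter]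
  refine Finset.sum_congr rfl fun z hz => ?_
  rw [if_pos hz]
  ring

theorem nbNext_zero (w : Fin 1 → V) : nbNext G w = G.neighborFinset (w 0) := by
  have h0 : (Fin.snoc (α := fun _ => V) w (w 0) : Fin 2 → V) (Fin.last 0).castSucc = w 0 :=
    Fin.snoc_castSucc (α := fun _ => V) (w 0) w 0
  ext z
  simp only [nbNext, nbChoices, Finset.mem_filter, SimpleGraph.mem_neighborFinset, h0]
  refine and_iff_left fun j hj => ?_
  simp at hj

theorem nbNext_succ {k : ℕ} (w : Fin (k + 2) → V) :
    nbNext G w = (G.neighborFinset (w (Fin.last (k + 1)))).erase (w (Fin.last k).castSucc) := by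
  have h0 : (Fin.snoc (α := fun _ => V) w (w 0) : Fin (k + 3) → V) (Fin.last (k + 1)).castSucc
      = w (Fin.last (k + 1)) := Fin.snoc_castSucc (α := fun _ => V) (w 0) w _
  have h1 : (Fin.snoc (α := fun _ => V) w (w 0) : Fin (k + 3) → V) (Fin.last k).castSucc.castSucc
      = w (Fin.last k).castSucc := Fin.snoc_castSucc (α := fun _ => V) (w 0) w _
  ext z
  simp only [nbNext, nbChoices, Finset.mem_filter, SimpleGraph.mem_neighborFinset, h0,
    Finset.mem_erase, Fin.val_last]
  rw [and_comm]
  refine and_congr_left fun _ => ⟨fun h => ?_, fun h j hj => ?_⟩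
  · have := h (Fin.last k).castSucc.castSucc (by simp)
    rwa [h1] at this
  · have hj' : j = (Fin.last k).castSucc.castSucc := Fin.ext (by simp; omega)
    rw [hj', h1]
    exact h

theorem adj_of_nbWalkProb_ne_zero {w₀ : V} {k : ℕ} {w : Fin (k + 2) → V}
    (h : nbWalkProb G w₀ (k + 1) w ≠ 0) :
    G.Adj (w (Fin.last (k + 1))) (w (Fin.last k).castSucc) := by
  unfold nbWalkProb at h
  have h1 := Finset.prod_ne_zero_iff.1 (right_ne_zero_of_mul h) (Fin.last k) (Finset.mem_univ _)
  by_cases hm : w (Fin.last k).succ ∈ nbChoices G w (Fin.last k)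
  · rw [nbChoices, Finset.mem_filter, SimpleGraph.mem_neighborFinset] at hm
    exact hm.1.symm
  · rw [if_neg hm] at h1
    exact absurd rfl h1

theorem visitCount_snoc {V : Type*} [DecidableEq V] {k : ℕ} (w : Fin (k + 1) → V) (z u : V) :
    visitCount (Fin.snoc (α := fun _ => V) w z : Fin (k + 2) → V) u
      = visitCount w u + if z = u then 1 else 0 := by
  unfold visitCount
  rw [Finset.card_filter, Finset.card_filter, Fin.sum_univ_castSucc]
  congr 1
  · refine Finset.sum_congr rfl fun i _ => ?_
    rw [Fin.succ_castSucc, Fin.snoc_castSucc]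
  · rw [Fin.succ_last, Fin.snoc_last]

theorem nbExp_congr {w₀ : V} {k : ℕ} {Φ Ψ : (Fin (k + 1) → V) → ℝ}
    (h : ∀ w, nbWalkProb G w₀ k w ≠ 0 → Φ w = Ψ w) : nbExp G w₀ k Φ = nbExp G w₀ k Ψ := by
  refine Finset.sum_congr rfl fun w _ => ?_
  by_cases h0 : nbWalkProb G w₀ k w = 0
  · rw [h0, zero_mul, zero_mul]
  · rw [h w h0]

/-- The first `k + 1` steps are taken in the path measure and the last `j` in the recursion; the
induction transfers one step at a time. Starting at one step ensures that a previous vertex exists.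
-/
theorem nbExp_visitCount_eq (hreg : G.IsRegularOfDegree d) (hd : 3 ≤ d) (w₀ u v : V)
    (Φ : ℕ → ℕ → ℝ) (j k m : ℕ) (hm : m = k + 1 + j) :
    nbExp G w₀ m (fun w => Φ (visitCount w u) (visitCount w v))
      = nbExp G w₀ (k + 1) fun w => nbVisitExp G d u v j (w (Fin.last k).castSucc)
          (w (Fin.last (k + 1))) fun a b => Φ (visitCount w u + a) (visitCount w v + b) := by
  induction j generalizing k with
  | zero =>
    subst hm
    simp [nbVisitExp]
  | succ j ih =>
    rw [ih (k + 1) (by omega), nbExp_succ]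
    refine nbExp_congr fun w hw => ?_
    have hcard := card_erase_neighborFinset hreg hd (adj_of_nbWalkProb_ne_zero hw)
    rw [nbNext_succ, hcard, nbVisitExp]
    congr 1
    refine Finset.sum_congr rfl fun z _ => ?_
    rw [Fin.snoc_castSucc, Fin.snoc_last]
    congr 1
    funext a b
    rw [visitCount_snoc, visitCount_snoc]
    congr 1 <;> ring

/-- The walk from `w₀` behaves like a walk that has just moved to `w₀` from a uniformly random
neighbour. -/
theorem nbExp_visitCount (hreg : G.IsRegularOfDegree d) (hd : 3 ≤ d) (w₀ u v : V)
    (Φ : ℕ → ℕ → ℝ) {n : ℕ} (hn : 0 < n) :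
    nbExp G w₀ n (fun w => Φ (visitCount w u) (visitCount w v))
      = (∑ p ∈ G.neighborFinset w₀, nbVisitExp G d u v n p w₀ Φ) / d := by
  have hd' : (3 : ℝ) ≤ d := by exact_mod_cast hd
  obtain ⟨j, rfl⟩ : ∃ j, n = 0 + 1 + j := ⟨n - 1, by omega⟩
  rw [nbExp_visitCount_eq hreg hd w₀ u v Φ j 0 _ rfl, nbExp_succ]
  set g : V → ℝ := fun z => nbVisitExp G d u v j w₀ z
    fun a b => Φ (a + if z = u then 1 else 0) (b + if z = v then 1 else 0) with hg
  have h1 : nbExp G w₀ 0 (fun w => (∑ z ∈ nbNext G w,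
      nbVisitExp G d u v j
        ((Fin.snoc (α := fun _ => V) w z : Fin 2 → V) (Fin.last 0).castSucc)
        ((Fin.snoc (α := fun _ => V) w z : Fin 2 → V) (Fin.last (0 + 1)))
        fun a b => Φ (visitCount (Fin.snoc (α := fun _ => V) w z : Fin 2 → V) u + a)
          (visitCount (Fin.snoc (α := fun _ => V) w z : Fin 2 → V) v + b)) /
            (nbNext G w).card)
      = nbExp G w₀ 0 (fun _ => (∑ z ∈ G.neighborFinset w₀, g z) / d) := by
    refine nbExp_congr fun w hw => ?_
    have hw0 : w 0 = w₀ := by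
      by_contra hne
      exact hw (by simp [nbWalkProb, hne])
    rw [nbNext_zero, hw0, G.card_neighborFinset_eq_degree, hreg w₀]
    congr 1
    refine Finset.sum_congr rfl fun z _ => ?_
    rw [Fin.snoc_castSucc, Fin.snoc_last, show w (Fin.last 0) = w₀ from hw0, hg]
    congr 1
    funext a b
    rw [visitCount_snoc, visitCount_snoc]
    simp [visitCount, add_comm]
  rw [h1]
  have h2 : nbExp G w₀ 0 (fun _ => (∑ z ∈ G.neighborFinset w₀, g z) / d)
      = (∑ z ∈ G.neighborFinset w₀, g z) / d := by
    rw [nbExp, ← Finset.sum_mul, sum_nbWalkProb G (fun v => by rw [hreg v]; omega), one_mul]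
  rw [h2]
  congr 1
  -- Summed over the `d` fictitious predecessors, each first step is forbidden once and allowed `d -
  -- 1` times, which restores the uniform first step.
  have h3 : ∀ p ∈ G.neighborFinset w₀, nbVisitExp G d u v (0 + 1 + j) p w₀ Φ
      = (∑ z ∈ G.neighborFinset w₀, g z - g p) / ((d : ℝ) - 1) := by
    intro p hp
    rw [show 0 + 1 + j = j + 1 by ring, nbVisitExp, ← Finset.add_sum_erase _ _ hp]
    ring
  rw [Finset.sum_congr rfl h3, ← Finset.sum_div, Finset.sum_sub_distrib, Finset.sum_const,
    G.card_neighborFinset_eq_degree, hreg w₀, nsmul_eq_mul, eq_div_iff (by linarith)]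
  ring

theorem nbExp_mono {w₀ : V} {k : ℕ} {Φ Ψ : (Fin (k + 1) → V) → ℝ} (h : ∀ w, Φ w ≤ Ψ w) :
    nbExp G w₀ k Φ ≤ nbExp G w₀ k Ψ :=
  Finset.sum_le_sum fun w _ => mul_le_mul_of_nonneg_left (h w) (nbWalkProb_nonneg w₀ k w)

theorem nbExp_sum {ι : Type*} (w₀ : V) (k : ℕ) (S : Finset ι)
    (Φ : ι → (Fin (k + 1) → V) → ℝ) :
    nbExp G w₀ k (fun w => ∑ i ∈ S, Φ i w) = ∑ i ∈ S, nbExp G w₀ k (Φ i) := by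
  simp only [nbExp, Finset.mul_sum]
  exact Finset.sum_comm

theorem nbExp_const_mul (w₀ : V) (k : ℕ) (c : ℝ) (Φ : (Fin (k + 1) → V) → ℝ) :
    nbExp G w₀ k (fun w => c * Φ w) = c * nbExp G w₀ k Φ := by
  simp only [nbExp, Finset.mul_sum]
  exact Finset.sum_congr rfl fun w _ => by ring

theorem nbExp_add (w₀ : V) (k : ℕ) (Φ Ψ : (Fin (k + 1) → V) → ℝ) :
    nbExp G w₀ k (fun w => Φ w + Ψ w) = nbExp G w₀ k Φ + nbExp G w₀ k Ψ := by
  simp only [nbExp, mul_add, Finset.sum_add_distrib]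

theorem nbExp_const (hreg : G.IsRegularOfDegree d) (hd : 3 ≤ d) (w₀ : V) (k : ℕ) (c : ℝ) :
    nbExp G w₀ k (fun _ => c) = c := by
  rw [nbExp, ← Finset.sum_mul, sum_nbWalkProb G (fun v => by rw [hreg v]; omega), one_mul]

theorem nbVisitExp_add (u v : V) (k : ℕ) (p x : V) (Φ Ψ : ℕ → ℕ → ℝ) :
    nbVisitExp G d u v k p x (fun a b => Φ a b + Ψ a b)
      = nbVisitExp G d u v k p x Φ + nbVisitExp G d u v k p x Ψ := by
  induction k generalizing p x Φ Ψ with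
  | zero => rfl
  | succ k ih => simp only [nbVisitExp, ih, Finset.sum_add_distrib, add_div]

theorem nbVisitExp_nonneg (hd : 3 ≤ d) (u v : V) (k : ℕ) (p x : V) (Φ : ℕ → ℕ → ℝ)
    (h : ∀ a b, 0 ≤ Φ a b) : 0 ≤ nbVisitExp G d u v k p x Φ := by
  have hd' : (3 : ℝ) ≤ d := by exact_mod_cast hd
  induction k generalizing p x Φ with
  | zero => exact h 0 0
  | succ k ih =>
    exact div_nonneg (Finset.sum_nonneg fun z _ => ih _ _ _ fun a b => h _ _) (by linarith)

end Expectation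

/-! ### Sums of powers compared with integrals -/

section Elementary

theorem pow_succ_add_le_add_pow {x c : ℝ} (hx : 0 ≤ x) (hc : 0 ≤ c) (m : ℕ) :
    x ^ (m + 1) + (m + 1) * c * x ^ m ≤ (x + c) ^ (m + 1) := by
  induction m with
  | zero => simp
  | succ m ih =>
    calc x ^ (m + 1 + 1) + ((m + 1 : ℕ) + 1) * c * x ^ (m + 1)
        ≤ (x ^ (m + 1) + (m + 1) * c * x ^ m) * (x + c) := by
          have : 0 ≤ (m + 1) * c * x ^ m * c := by positivity
          push_cast
          rw [pow_succ x (m + 1), pow_succ x m] at *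
          linarith
      _ ≤ (x + c) ^ (m + 1) * (x + c) := by gcongr
      _ = _ := by ring

theorem add_pow_succ_le {x c : ℝ} (hx : 0 ≤ x) (hc : 0 ≤ c) (m : ℕ) :
    (x + c) ^ (m + 1) ≤ x ^ (m + 1) + (m + 1) * c * (x + c) ^ m := by
  induction m with
  | zero => simp
  | succ m ih =>
    have h1 : x ^ (m + 1) ≤ (x + c) ^ (m + 1) := by gcongr; linarith
    calc (x + c) ^ (m + 1 + 1) = (x + c) ^ (m + 1) * (x + c) := by ring
      _ ≤ (x ^ (m + 1) + (m + 1) * c * (x + c) ^ m) * (x + c) := by gcongr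
      _ = x ^ (m + 1 + 1) + c * x ^ (m + 1) + (m + 1) * c * (x + c) ^ (m + 1) := by ring
      _ ≤ x ^ (m + 1 + 1) + c * (x + c) ^ (m + 1) + (m + 1) * c * (x + c) ^ (m + 1) := by gcongr
      _ = _ := by push_cast; ring

/-- A lower Riemann sum for the integral of `(c * x + b) ^ m`, proved by telescoping; it is the gain
of `1 / (m + 1)` that builds up the factorials in the moments. -/
theorem sum_affine_pow_le {b c : ℝ} (hb : 0 ≤ b) (hc : 0 ≤ c) (m N : ℕ) :
    (m + 1) * (c * ∑ j ∈ Finset.range N, (c * j + b) ^ m) ≤ (c * N + b) ^ (m + 1) := by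
  induction N with
  | zero => simp; positivity
  | succ N ih =>
    have h := pow_succ_add_le_add_pow (show 0 ≤ c * N + b by positivity) hc m
    rw [Finset.sum_range_succ]
    calc (m + 1) * (c * (∑ j ∈ Finset.range N, (c * j + b) ^ m + (c * N + b) ^ m))
        = (m + 1) * (c * ∑ j ∈ Finset.range N, (c * j + b) ^ m)
          + (m + 1) * c * (c * N + b) ^ m := by ring
      _ ≤ (c * N + b + c) ^ (m + 1) := by linarith
      _ = _ := by push_cast; ring

/-- The matching upper Riemann sum, with the affine function cut off at zero. -/
theorem le_sum_max_affine_pow {b c : ℝ} (hb : 0 ≤ b) (hc : 0 ≤ c) (m K : ℕ) :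
    max 0 (c * K - b) ^ (m + 1)
      ≤ (m + 1) * (c * ∑ j ∈ Finset.range K, max 0 (c * (j + 1 : ℕ) - b) ^ m) := by
  induction K with
  | zero => simp [hb]
  | succ K ih =>
    rw [Finset.sum_range_succ]
    have key : max 0 (c * (K + 1 : ℕ) - b) ^ (m + 1) ≤ max 0 (c * K - b) ^ (m + 1)
        + (m + 1) * c * max 0 (c * (K + 1 : ℕ) - b) ^ m := by
      have hx : 0 ≤ max 0 (c * K - b) := le_max_left _ _
      rcases le_total (c * (K + 1 : ℕ) - b) 0 with h0 | h0
      · rw [max_eq_left h0, zero_pow (Nat.succ_ne_zero m)]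
        positivity
      rw [max_eq_right h0]
      rcases le_total 0 (c * K - b) with h1 | h1
      · rw [max_eq_right h1]
        have := add_pow_succ_le h1 hc m
        have e : c * (K + 1 : ℕ) - b = c * K - b + c := by push_cast; ring
        rw [e]
        exact this
      · rw [max_eq_left h1, zero_pow (Nat.succ_ne_zero m), zero_add, pow_succ, mul_comm]
        have h2 : c * (K + 1 : ℕ) - b ≤ (m + 1) * c := by
          push_cast
          nlinarith [mul_nonneg (Nat.cast_nonneg (α := ℝ) m) hc]
        gcongr
    calc _ ≤ _ := key
      _ ≤ (m + 1) * (c * ∑ j ∈ Finset.range K, max 0 (c * (j + 1 : ℕ) - b) ^ m)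
          + (m + 1) * c * max 0 (c * (K + 1 : ℕ) - b) ^ m := by gcongr
      _ = _ := by ring

/-- Here `b i` plays the role of a hitting probability that exceeds its limiting bound `c` only
before mixing. Monotonicity charges each of the `M` exceptional terms to `g N`. -/
theorem sum_mul_reflect_le {b g : ℕ → ℝ} {c β : ℝ} {M : ℕ} (hβ : 0 ≤ β)
    (hb : ∀ i, b i ≤ c + if i < M then β else 0) (hg : ∀ j, 0 ≤ g j) (hmono : Monotone g)
    (N : ℕ) :
    ∑ i ∈ Finset.range N, b i * g (N - 1 - i)
      ≤ c * ∑ j ∈ Finset.range N, g j + M * β * g N := by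
  have h1 : ∑ i ∈ Finset.range N, b i * g (N - 1 - i)
      ≤ ∑ i ∈ Finset.range N, (c * g (N - 1 - i) + (if i < M then β else 0) * g N) := by
    refine Finset.sum_le_sum fun i _ => ?_
    have h2 : (if i < M then β else 0) * g (N - 1 - i) ≤ (if i < M then β else 0) * g N := by
      refine mul_le_mul_of_nonneg_left (hmono (by omega)) ?_
      split_ifs <;> [exact hβ; exact le_rfl]
    have h3 := mul_le_mul_of_nonneg_right (hb i) (hg (N - 1 - i))
    linarith
  refine h1.trans ?_
  rw [Finset.sum_add_distrib, ← Finset.mul_sum, Finset.sum_range_reflect, ← Finset.sum_mul]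
  have h4 : ∑ i ∈ Finset.range N, (if i < M then β else 0) ≤ M * β := by
    rw [← Finset.sum_filter, Finset.sum_const, nsmul_eq_mul]
    refine mul_le_mul_of_nonneg_right ?_ hβ
    have : (Finset.range N).filter (fun i => i < M) ⊆ Finset.range M := fun i hi =>
      Finset.mem_range.2 (Finset.mem_filter.1 hi).2
    exact_mod_cast (Finset.card_le_card this).trans (Finset.card_range M).le
  have := mul_le_mul_of_nonneg_right h4 (hg N)
  linarith

end Elementary

/-! ### Joint factorial moments of two visit counts -/

section FactorialMoments

variable {V : Type*} [Fintype V] [DecidableEq V] (G : SimpleGraph V) [DecidableRel G.Adj]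

/-- The joint factorial moment `E[C(X_u, r) C(X_v, s)]` of the numbers of visits to `u` and `v`
during `N` steps. -/
def nbMoment (d : ℕ) (u v : V) (r s N : ℕ) (p x : V) : ℝ :=
  nbVisitExp G d u v N p x fun a b => (a.choose r : ℝ) * b.choose s

variable {G} {d : ℕ}

theorem nbMoment_nonneg (hd : 3 ≤ d) (u v : V) (r s N : ℕ) (p x : V) :
    0 ≤ nbMoment G d u v r s N p x :=
  nbVisitExp_nonneg hd u v N p x _ fun a b => by positivity

theorem nbMoment_zero_steps (u v : V) {r s : ℕ} (h : 0 < r + s) (p x : V) :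
    nbMoment G d u v r s 0 p x = 0 := by
  simp only [nbMoment, nbVisitExp]
  rcases Nat.eq_zero_or_pos r with rfl | hr
  · rw [Nat.choose_eq_zero_of_lt (show 0 < s by omega), Nat.cast_zero, mul_zero]
  · rw [Nat.choose_eq_zero_of_lt hr, Nat.cast_zero, zero_mul]

theorem nbMoment_zero_zero (hreg : G.IsRegularOfDegree d) (hd : 3 ≤ d) (u v : V) (N : ℕ)
    (p x : V) (hxp : G.Adj x p) : nbMoment G d u v 0 0 N p x = 1 := by
  have hd' : (3 : ℝ) ≤ d := by exact_mod_cast hd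
  unfold nbMoment
  simp only [Nat.choose_zero_right, Nat.cast_one, mul_one]
  induction N generalizing p x with
  | zero => rfl
  | succ N ih =>
    rw [nbVisitExp, Finset.sum_congr rfl fun z hz => ih x z (adj_of_mem_erase hz),
      Finset.sum_const, nsmul_eq_mul, card_erase_neighborFinset hreg hd hxp, mul_one,
      div_self (by linarith)]

/-- Pascal's rule: a visit to `u` either is left out of the chosen visits or is one of them and
lowers `r` by one. As `u ≠ v`, a single step lowers at most one of the orders. -/
theorem nbMoment_succ {u v : V} (huv : u ≠ v) (r s N : ℕ) (p x : V) :
    nbMoment G d u v r s (N + 1) p x = (∑ z ∈ (G.neighborFinset x).erase p,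
      (nbMoment G d u v r s N x z
        + (if z = u then (if r = 0 then 0 else nbMoment G d u v (r - 1) s N x u) else 0)
        + if z = v then (if s = 0 then 0 else nbMoment G d u v r (s - 1) N x v) else 0))
      / ((d : ℝ) - 1) := by
  rw [nbMoment, nbVisitExp]
  congr 1
  refine Finset.sum_congr rfl fun z _ => ?_
  by_cases hu : z = u
  · subst hu
    simp only [if_true, if_neg huv, add_zero]
    rcases r with - | r
    · simp [nbMoment]
    · rw [if_neg (Nat.succ_ne_zero r), Nat.add_sub_cancel]
      unfold nbMoment
      rw [← nbVisitExp_add]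
      congr 1
      funext a b
      rw [Nat.choose_succ_succ, Nat.cast_add]
      ring
  · by_cases hv : z = v
    · subst hv
      simp only [if_true, if_neg hu, add_zero]
      rcases s with - | s
      · simp [nbMoment]
      · rw [if_neg (Nat.succ_ne_zero s), Nat.add_sub_cancel]
        unfold nbMoment
        rw [← nbVisitExp_add]
        congr 1
        funext a b
        rw [Nat.choose_succ_succ, Nat.cast_add]
        ring
    · simp [if_neg hu, if_neg hv, nbMoment]

/-- Duhamel's principle: a source that acts on arrival at `u` or `v` is weighted by the probability
of arriving there at that time. The one-sided form serves upper bounds, and also lower bounds after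
a change of sign. -/
theorem le_sum_nbHit_of_recursion (hd : 3 ≤ d) (u v : V) (Y : ℕ → V → V → ℝ) (g g' : ℕ → ℝ)
    (h0 : ∀ p x, Y 0 p x ≤ 0)
    (hrec : ∀ k p x, G.Adj x p → Y (k + 1) p x ≤ (∑ z ∈ (G.neighborFinset x).erase p,
      (Y k x z + (if z = u then g k else 0) + if z = v then g' k else 0)) / ((d : ℝ) - 1))
    (N : ℕ) (p x : V) (hxp : G.Adj x p) :
    Y N p x ≤ ∑ i ∈ Finset.range N, nbHit G d u (i + 1) p x * g (N - 1 - i)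
      + ∑ i ∈ Finset.range N, nbHit G d v (i + 1) p x * g' (N - 1 - i) := by
  have hd' : (3 : ℝ) ≤ d := by exact_mod_cast hd
  induction N generalizing p x with
  | zero => simpa using h0 p x
  | succ N ih =>
    have hexp : ∀ (y : V) (f : ℕ → ℝ), ∑ i ∈ Finset.range (N + 1),
        nbHit G d y (i + 1) p x * f (N + 1 - 1 - i) = (∑ z ∈ (G.neighborFinset x).erase p,
        (∑ i ∈ Finset.range N, nbHit G d y (i + 1) x z * f (N - 1 - i)
          + if z = y then f N else 0)) / ((d : ℝ) - 1) := by
      intro y f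
      have : ∀ z, ∑ i ∈ Finset.range N, nbHit G d y (i + 1) x z * f (N - 1 - i)
          + (if z = y then f N else 0)
          = ∑ i ∈ Finset.range (N + 1), nbHit G d y i x z * f (N - i) := by
        intro z
        rw [Finset.sum_range_succ']
        congr 1
        · refine Finset.sum_congr rfl fun i _ => ?_
          rw [show N - 1 - i = N - (i + 1) by omega]
        · simp [nbHit]
      simp only [this]
      rw [Finset.sum_comm, Finset.sum_div]
      refine Finset.sum_congr rfl fun i _ => ?_
      rw [nbHit, ← Finset.sum_mul, Nat.add_sub_cancel]
      ring
    rw [hexp, hexp, ← add_div, ← Finset.sum_add_distrib]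
    refine (hrec N p x hxp).trans
      (div_le_div_of_nonneg_right (Finset.sum_le_sum fun z hz => ?_) (by linarith))
    have := ih x z (adj_of_mem_erase hz)
    linarith

theorem nbMoment_le_of_prev {u v : V} (hd : 3 ≤ d) (huv : u ≠ v) (r s : ℕ) (hrs : 0 < r + s)
    (g g' : ℕ → ℝ)
    (hg : ∀ N x, G.Adj u x → (if r = 0 then 0 else nbMoment G d u v (r - 1) s N x u) ≤ g N)
    (hg' : ∀ N x, G.Adj v x → (if s = 0 then 0 else nbMoment G d u v r (s - 1) N x v) ≤ g' N)
    (N : ℕ) (p x : V) (hxp : G.Adj x p) :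
    nbMoment G d u v r s N p x
      ≤ ∑ i ∈ Finset.range N, nbHit G d u (i + 1) p x * g (N - 1 - i)
      + ∑ i ∈ Finset.range N, nbHit G d v (i + 1) p x * g' (N - 1 - i) := by
  have hd' : (3 : ℝ) ≤ d := by exact_mod_cast hd
  refine le_sum_nbHit_of_recursion hd u v (nbMoment G d u v r s) g g'
    (fun p x => (nbMoment_zero_steps u v hrs p x).le) (fun k p x _ => ?_) N p x hxp
  rw [nbMoment_succ huv]
  gcongr with z hz
  · linarith
  · split_ifs with h1 h2
    · subst h1
      simpa [h2] using hg k x (adj_of_mem_erase hz)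
    · subst h1
      simpa [h2] using hg k x (adj_of_mem_erase hz)
    · exact le_rfl
  · split_ifs with h1 h2
    · subst h1
      simpa [h2] using hg' k x (adj_of_mem_erase hz)
    · subst h1
      simpa [h2] using hg' k x (adj_of_mem_erase hz)
    · exact le_rfl

theorem le_nbMoment_of_prev {u v : V} (hd : 3 ≤ d) (huv : u ≠ v) (r s : ℕ) (g g' : ℕ → ℝ)
    (hg : ∀ N x, G.Adj u x → g N ≤ (if r = 0 then 0 else nbMoment G d u v (r - 1) s N x u))
    (hg' : ∀ N x, G.Adj v x → g' N ≤ (if s = 0 then 0 else nbMoment G d u v r (s - 1) N x v))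
    (N : ℕ) (p x : V) (hxp : G.Adj x p) :
    ∑ i ∈ Finset.range N, nbHit G d u (i + 1) p x * g (N - 1 - i)
      + ∑ i ∈ Finset.range N, nbHit G d v (i + 1) p x * g' (N - 1 - i)
      ≤ nbMoment G d u v r s N p x := by
  have hd' : (3 : ℝ) ≤ d := by exact_mod_cast hd
  have h := le_sum_nbHit_of_recursion (G := G) hd u v (fun N p x => - nbMoment G d u v r s N p x)
    (fun N => - g N) (fun N => - g' N)
    (fun p x => neg_nonpos.2 (nbMoment_nonneg hd u v r s 0 p x)) (fun k p x _ => ?_) N p x hxp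
  · simp only [mul_neg, Finset.sum_neg_distrib] at h
    linarith
  · simp only [nbMoment_succ huv]
    rw [← neg_div, ← Finset.sum_neg_distrib]
    gcongr with z hz
    · linarith
    · rw [neg_add, neg_add]
      gcongr
      · split_ifs with h1 h2
        · subst h1
          simpa [h2] using hg k x (adj_of_mem_erase hz)
        · subst h1
          simpa [h2] using hg k x (adj_of_mem_erase hz)
        · simp
      · split_ifs with h1 h2
        · subst h1
          simpa [h2] using hg' k x (adj_of_mem_erase hz)
        · subst h1
          simpa [h2] using hg' k x (adj_of_mem_erase hz)
        · simp

theorem prev_div_factorial_le (r s : ℕ) {A B : ℝ}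
    (h : ∀ r', r = r' + 1 → A ≤ B / (r' ! * s !)) :
    (if r = 0 then 0 else A) ≤ r * B / (r ! * s !) := by
  rcases r with - | r
  · simp
  · rw [if_neg (Nat.succ_ne_zero r)]
    refine (h r rfl).trans (le_of_eq ?_)
    rw [Nat.factorial_succ]
    push_cast
    field_simp

theorem le_prev_div_factorial (r s : ℕ) {A B : ℝ}
    (h : ∀ r', r = r' + 1 → B / (r' ! * s !) ≤ A) :
    r * B / (r ! * s !) ≤ (if r = 0 then 0 else A) := by
  rcases r with - | r
  · simp
  · rw [if_neg (Nat.succ_ne_zero r)]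
    refine (le_of_eq ?_).trans (h r rfl)
    rw [Nat.factorial_succ]
    push_cast
    field_simp

/-- After the earliest chosen visit the walk restarts at `u` or `v`, which is why `S` must contain
both. Choosing `u` or `v` contributes `r + s` in total, the Riemann sum absorbs it, and the `M`
unmixed steps after each restart raise the base by `M * β`. -/
theorem nbMoment_le (hreg : G.IsRegularOfDegree d) (hd : 3 ≤ d) {u v : V} (huv : u ≠ v)
    {c β : ℝ} {M : ℕ} (hc : 0 ≤ c) (hβ : 0 ≤ β)
    (hmix : ∀ y k p x, M ≤ k → G.Adj x p → nbHit G d y k p x ≤ c)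
    (S : V → Prop) (hSu : S u) (hSv : S v)
    (hS : ∀ x, S x → ∀ p k, G.Adj x p → 1 ≤ k →
      nbHit G d u k p x ≤ β ∧ nbHit G d v k p x ≤ β)
    (m r s : ℕ) (hm : r + s = m) (N : ℕ) (p x : V) (hx : S x) (hxp : G.Adj x p) :
    nbMoment G d u v r s N p x ≤ (c * N + m * (M * β)) ^ m / (r ! * s !) := by
  induction m generalizing r s N p x with
  | zero =>
    obtain ⟨rfl, rfl⟩ : r = 0 ∧ s = 0 := by omega
    simp [nbMoment_zero_zero hreg hd u v N p x hxp]
  | succ m ih =>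
    set ε : ℝ := M * β with hε
    have hε0 : 0 ≤ ε := by positivity
    set f : ℕ → ℝ := fun N => (c * N + m * ε) ^ m with hf
    have hf0 : ∀ N, 0 ≤ f N := fun N => by simp only [hf]; positivity
    have hfmono : Monotone f := by
      intro a b hab
      have : (a : ℝ) ≤ b := by exact_mod_cast hab
      simp only [hf]
      gcongr
    have hb : ∀ y, (∀ k, 1 ≤ k → nbHit G d y k p x ≤ β) → ∀ i,
        nbHit G d y (i + 1) p x ≤ c + if i < M then β else 0 := by
      intro y hy i
      split_ifs with hi
      · linarith [hy (i + 1) (by omega)]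
      · linarith [hmix y (i + 1) p x (by omega) hxp]
    have hconv : ∀ (y : V), (∀ k, 1 ≤ k → nbHit G d y k p x ≤ β) → ∀ q : ℕ,
        ∑ i ∈ Finset.range N, nbHit G d y (i + 1) p x * (q * f (N - 1 - i) / (r ! * s !))
        ≤ q / (r ! * s !) * (c * ∑ j ∈ Finset.range N, f j + ε * f N) := by
      intro y hy q
      have h1 := sum_mul_reflect_le hβ (hb y hy) hf0 hfmono N
      rw [← hε] at h1
      calc _ = q / (r ! * s !) * ∑ i ∈ Finset.range N, nbHit G d y (i + 1) p x * f (N - 1 - i) := by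
            rw [Finset.mul_sum]
            exact Finset.sum_congr rfl fun i _ => by ring
        _ ≤ _ := by gcongr
    have h := nbMoment_le_of_prev hd huv r s (by omega) (fun N => r * f N / (r ! * s !))
      (fun N => s * f N / (r ! * s !))
      (fun N x hx => prev_div_factorial_le r s fun r' hr' =>
        (by subst hr'; exact ih r' s (by omega) N x u hSu hx))
      (fun N x hx => by
        rw [mul_comm (r ! : ℝ)]
        refine prev_div_factorial_le s r fun s' hs' => ?_
        subst hs'
        rw [mul_comm (s' ! : ℝ)]
        exact ih r s' (by omega) N x v hSv hx) N p x hxp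
    refine h.trans ?_
    have hu := hconv u (fun k hk => (hS x hx p k hxp hk).1) r
    have hv := hconv v (fun k hk => (hS x hx p k hxp hk).2) s
    have hsum := sum_affine_pow_le (show 0 ≤ m * ε by positivity) hc m N
    have hpow := pow_succ_add_le_add_pow (show 0 ≤ c * N + m * ε by positivity) hε0 m
    have hrs : (r : ℝ) + s = m + 1 := by exact_mod_cast hm
    calc _ ≤ r / (r ! * s !) * (c * ∑ j ∈ Finset.range N, f j + ε * f N)
          + s / (r ! * s !) * (c * ∑ j ∈ Finset.range N, f j + ε * f N) := add_le_add hu hv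
      _ = ((r : ℝ) + s) * (c * ∑ j ∈ Finset.range N, f j + ε * f N) / (r ! * s !) := by ring
      _ = ((m + 1) * (c * ∑ j ∈ Finset.range N, f j) + (m + 1) * ε * f N) / (r ! * s !) := by
          rw [hrs]; ring
      _ ≤ (c * N + m * ε + ε) ^ (m + 1) / (r ! * s !) := by
          gcongr
          simp only [hf]
          linarith
      _ = _ := by push_cast; ring

/-- From an arbitrary start only the first visit lacks the bound `β`; using the bound 1 for it costs
the factor `c * N + M`. All later restarts are at `u`. -/
theorem nbMoment_le_of_start (hreg : G.IsRegularOfDegree d) (hd : 3 ≤ d) {u v : V} (huv : u ≠ v)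
    {c β : ℝ} {M : ℕ} (hc : 0 ≤ c) (hβ : 0 ≤ β)
    (hmix : ∀ y k p x, M ≤ k → G.Adj x p → nbHit G d y k p x ≤ c)
    (S : V → Prop) (hSu : S u) (hSv : S v)
    (hS : ∀ x, S x → ∀ p k, G.Adj x p → 1 ≤ k →
      nbHit G d u k p x ≤ β ∧ nbHit G d v k p x ≤ β)
    (r N : ℕ) (p x : V) (hxp : G.Adj x p) :
    nbMoment G d u v (r + 1) 0 N p x ≤ (c * N + M) * ((c * N + r * (M * β)) ^ r / r !) := by
  set f : ℕ → ℝ := fun N => (c * N + r * (M * β)) ^ r / r ! with hf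
  have hf0 : ∀ N, 0 ≤ f N := fun N => by simp only [hf]; positivity
  have hfmono : Monotone f := by
    intro a b hab
    have : (a : ℝ) ≤ b := by exact_mod_cast hab
    simp only [hf]
    gcongr
  have h := nbMoment_le_of_prev hd huv (r + 1) 0 (by omega) f (fun _ => 0)
    (fun N x hx => by
      have := nbMoment_le hreg hd huv hc hβ hmix S hSu hSv hS r r 0 (by omega) N x u hSu hx
      simpa [hf] using this)
    (fun N x hx => by simp) N p x hxp
  refine h.trans ?_
  simp only [mul_zero, Finset.sum_const_zero, add_zero]
  have hb : ∀ i, nbHit G d u (i + 1) p x ≤ c + if i < M then 1 else 0 := by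
    intro i
    split_ifs with hi
    · linarith [nbHit_le_one hreg hd u (i + 1) p x hxp]
    · linarith [hmix u (i + 1) p x (by omega) hxp]
  refine (sum_mul_reflect_le zero_le_one hb hf0 hfmono N).trans ?_
  have h1 := Finset.sum_le_card_nsmul (Finset.range N) f (f N)
    fun j hj => hfmono (Finset.mem_range.1 hj).le
  rw [Finset.card_range, nsmul_eq_mul] at h1
  have h2 := mul_le_mul_of_nonneg_left h1 hc
  linarith

/-- Hits before time `M` after each restart are discarded, so every chosen visit shortens the
available time by at most `M`. -/
theorem le_nbMoment (hreg : G.IsRegularOfDegree d) (hd : 3 ≤ d) {u v : V} (huv : u ≠ v)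
    {c : ℝ} {M : ℕ} (hc : 0 ≤ c) (hM : 0 < M)
    (hmix : ∀ y k p x, M ≤ k → G.Adj x p → c ≤ nbHit G d y k p x)
    (m r s : ℕ) (hm : r + s = m) (N : ℕ) (p x : V) (hxp : G.Adj x p) :
    max 0 (c * N - c * (m * M)) ^ m / (r ! * s !) ≤ nbMoment G d u v r s N p x := by
  induction m generalizing r s N p x with
  | zero =>
    obtain ⟨rfl, rfl⟩ : r = 0 ∧ s = 0 := by omega
    simp [nbMoment_zero_zero hreg hd u v N p x hxp]
  | succ m ih =>
    rcases lt_or_ge N M with hNM | hNM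
    · have : c * N - c * ((m + 1 : ℕ) * M) ≤ 0 := by
        have h1 : (N : ℝ) ≤ M := by exact_mod_cast hNM.le
        have h2 : (M : ℝ) ≤ (m + 1 : ℕ) * M := by
          push_cast
          nlinarith [mul_nonneg (Nat.cast_nonneg (α := ℝ) m) (Nat.cast_nonneg (α := ℝ) M)]
        nlinarith [mul_le_mul_of_nonneg_left (h1.trans h2) hc]
      rw [max_eq_left this, zero_pow (Nat.succ_ne_zero m), zero_div]
      exact nbMoment_nonneg hd u v r s N p x
    set b : ℝ := c * (m * M) with hb
    have hb0 : 0 ≤ b := by positivity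
    set f : ℕ → ℝ := fun N => max 0 (c * N - b) ^ m with hf
    have hf0 : ∀ N, 0 ≤ f N := fun N => by simp only [hf]; positivity
    obtain ⟨K, rfl⟩ : ∃ K, N = K + M := ⟨N - M, by omega⟩
    have hconv : ∀ (y : V) (q : ℕ), q / (r ! * s !) * (c * ∑ j ∈ Finset.range K, f (j + 1))
        ≤ ∑ i ∈ Finset.range (K + M),
          nbHit G d y (i + 1) p x * (q * f (K + M - 1 - i) / (r ! * s !)) := by
      intro y q
      have h1 : c * ∑ j ∈ Finset.range K, f (j + 1)
          ≤ ∑ i ∈ Finset.range (K + M), nbHit G d y (i + 1) p x * f (K + M - 1 - i) := by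
        rw [← Finset.sum_range_reflect (n := K + M)]
        -- The remaining time `j ≤ K` corresponds to a hit at time `K + M - j ≥ M`. The term `j = 0`
        -- is dropped afterwards to match the upper Riemann sum.
        have h2 : ∑ j ∈ Finset.range (K + 1), c * f j ≤ ∑ j ∈ Finset.range (K + M),
            nbHit G d y (K + M - 1 - j + 1) p x * f (K + M - 1 - (K + M - 1 - j)) := by
          refine (Finset.sum_le_sum fun j hj => ?_).trans
            (Finset.sum_le_sum_of_subset_of_nonneg (Finset.range_subset_range.2
              (show K + 1 ≤ K + M by omega)) fun j _ _ =>
                mul_nonneg (nbHit_nonneg hd _ _ _ _) (hf0 _))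
          have hj' := Finset.mem_range.1 hj
          rw [show K + M - 1 - (K + M - 1 - j) = j by omega]
          exact mul_le_mul_of_nonneg_right (hmix y _ p x (by omega) hxp) (hf0 j)
        refine le_trans ?_ h2
        rw [← Finset.mul_sum, Finset.sum_range_succ']
        gcongr
        linarith [hf0 0]
      calc _ ≤ q / (r ! * s !) * ∑ i ∈ Finset.range (K + M),
            nbHit G d y (i + 1) p x * f (K + M - 1 - i) := by gcongr
        _ = _ := by
            rw [Finset.mul_sum]
            exact Finset.sum_congr rfl fun i _ => by ring
    have h := le_nbMoment_of_prev hd huv r s (fun N => r * f N / (r ! * s !))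
      (fun N => s * f N / (r ! * s !))
      (fun N x hx => le_prev_div_factorial r s fun r' hr' =>
        (by subst hr'; exact ih r' s (by omega) N x u hx))
      (fun N x hx => by
        rw [mul_comm (r ! : ℝ)]
        refine le_prev_div_factorial s r fun s' hs' => ?_
        subst hs'
        rw [mul_comm (s' ! : ℝ)]
        exact ih r s' (by omega) N x v hx) (K + M) p x hxp
    refine le_trans ?_ h
    have hsum := le_sum_max_affine_pow hb0 hc m K
    have hrs : (r : ℝ) + s = m + 1 := by exact_mod_cast hm
    have e : c * (K + M : ℕ) - c * ((m + 1 : ℕ) * M) = c * K - b := by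
      rw [hb]; push_cast; ring
    rw [e]
    calc _ ≤ (m + 1) * (c * ∑ j ∈ Finset.range K, f (j + 1)) / (r ! * s !) := by gcongr
      _ = r / (r ! * s !) * (c * ∑ j ∈ Finset.range K, f (j + 1))
          + s / (r ! * s !) * (c * ∑ j ∈ Finset.range K, f (j + 1)) := by rw [← hrs]; ring
      _ ≤ _ := add_le_add (hconv u r) (hconv v s)

end FactorialMoments

/-! ### Bonferroni inequalities and Poisson probabilities -/

section Sieve

/-- The Bonferroni truncation, after `J` terms, of the indicator of `X = t`. -/
def altTrunc (J t X : ℕ) : ℝ :=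
  ∑ j ∈ Finset.range J, (-1) ^ j * ((t + j).choose t : ℝ) * X.choose (t + j)

theorem altTrunc_eq (J t X : ℕ) :
    altTrunc J t X = X.choose t * ∑ j ∈ Finset.range J, (-1) ^ j * ((X - t).choose j : ℝ) := by
  rw [altTrunc, Finset.mul_sum]
  refine Finset.sum_congr rfl fun j _ => ?_
  have h : X.choose (t + j) * (t + j).choose t = X.choose t * (X - t).choose j := by
    rw [Nat.choose_mul (Nat.le_add_right t j), Nat.add_sub_cancel_left]
  have h' : (X.choose (t + j) : ℝ) * (t + j).choose t = X.choose t * (X - t).choose j := by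
    exact_mod_cast h
  linear_combination (-1) ^ j * h'

theorem altTrunc_self (m t : ℕ) : altTrunc (m + 1) t t = 1 := by
  rw [altTrunc_eq, Nat.choose_self, Nat.sub_self, Finset.sum_range_succ']
  simp

theorem altTrunc_of_lt {J t X : ℕ} (h : X < t) : altTrunc J t X = 0 := by
  rw [altTrunc_eq, Nat.choose_eq_zero_of_lt h, Nat.cast_zero, zero_mul]

/-- A truncated alternating row of Pascal's triangle collapses to one binomial coefficient with the
sign of its last term. An odd number of terms thus overestimates the indicator, and an even number
underestimates it. -/
theorem altTrunc_of_gt (m : ℕ) {t X : ℕ} (h : t < X) :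
    altTrunc (m + 1) t X = (-1) ^ m * (X.choose t * (X - t - 1).choose m) := by
  obtain ⟨Y, rfl⟩ : ∃ Y, X = t + (Y + 1) := ⟨X - t - 1, by omega⟩
  rw [altTrunc_eq, Nat.add_sub_cancel_left, Nat.add_sub_cancel]
  have := Int.alternating_sum_range_choose_eq_choose (n := Y) (m := m)
  have h' : ∑ j ∈ Finset.range (m + 1), (-1) ^ j * ((Y + 1).choose j : ℝ)
      = (-1) ^ m * Y.choose m := by exact_mod_cast this
  rw [h']
  ring

theorem indicator_le_altTrunc (m t X : ℕ) :
    (if X = t then 1 else 0 : ℝ) ≤ altTrunc (2 * m + 1) t X := by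
  rcases lt_trichotomy X t with h | rfl | h
  · rw [if_neg h.ne, altTrunc_of_lt h]
  · rw [if_pos rfl, altTrunc_self]
  · rw [if_neg h.ne', altTrunc_of_gt _ h, Even.neg_one_pow ⟨m, by ring⟩, one_mul]
    positivity

theorem altTrunc_le_indicator (m t X : ℕ) :
    altTrunc (2 * m + 2) t X ≤ (if X = t then 1 else 0 : ℝ) := by
  rcases lt_trichotomy X t with h | rfl | h
  · rw [if_neg h.ne, altTrunc_of_lt h]
  · rw [if_pos rfl, altTrunc_self]
  · rw [if_neg h.ne', altTrunc_of_gt _ h, Odd.neg_one_pow ⟨m, rfl⟩]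
    have : (0 : ℝ) ≤ X.choose t * (X - t - 1).choose (2 * m + 1) := by positivity
    linarith

theorem choose_div_factorial (t j : ℕ) :
    ((t + j).choose t : ℝ) / (t + j)! = 1 / (t ! * j !) := by
  have h := Nat.choose_mul_factorial_mul_factorial (Nat.le_add_right t j)
  rw [Nat.add_sub_cancel_left] at h
  have h' : ((t + j).choose t : ℝ) * t ! * j ! = (t + j)! := by exact_mod_cast h
  rw [div_eq_div_iff (by positivity) (by positivity), ← h']
  ring

theorem abs_sum_alternating_sub_exp_le {J : ℕ} (hJ : 0 < J) :
    |∑ j ∈ Finset.range J, (-1 : ℝ) ^ j / (j ! : ℝ) - Real.exp (-1)| ≤ 2 / J ! := by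
  rw [abs_sub_comm]
  refine (Real.exp_bound (by simp) hJ).trans ?_
  have hJ' : (1 : ℝ) ≤ J := by exact_mod_cast hJ
  simp only [abs_neg, abs_one, one_pow, one_mul, Nat.succ_eq_add_one]
  rw [div_le_div_iff₀ (by positivity) (by positivity)]
  have : (0 : ℝ) < J ! := by positivity
  push_cast
  nlinarith

theorem sum_inv_factorial_le (J : ℕ) : ∑ j ∈ Finset.range J, (1 : ℝ) / j ! ≤ 3 := by
  have h := Real.sum_le_exp_of_nonneg (zero_le_one (α := ℝ)) J
  simp only [one_pow] at h
  linarith [Real.exp_one_lt_d9]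

variable {V : Type*} [Fintype V] [DecidableEq V] {G : SimpleGraph V} [DecidableRel G.Adj]
  {d : ℕ}

theorem nbExp_neg_pow_mul {w₀ : V} {k : ℕ} {Φ : (Fin (k + 1) → V) → ℝ} {B a : ℝ} {η : ℝ}
    (h : |nbExp G w₀ k Φ - B| ≤ η) :
    a * B - |a| * η ≤ nbExp G w₀ k (fun w => a * Φ w) ∧
      nbExp G w₀ k (fun w => a * Φ w) ≤ a * B + |a| * η := by
  rw [nbExp_const_mul]
  have h1 : |a * nbExp G w₀ k Φ - a * B| ≤ |a| * η := by
    rw [← mul_sub, abs_mul]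
    gcongr
  rw [abs_le] at h1
  constructor <;> linarith [h1.1, h1.2]

/-- With Poisson moments `1 / r !` the truncated series is `1 / t !` times a partial sum of `exp
(-1)`. Relative moment errors keep the factor `1 / t !` and sum to at most `η * ∑ 1 / j ! ≤ 3 * η`.
-/
theorem nbExp_visited_ge {w₀ u : V} {n t m : ℕ} {η : ℝ} (hη : 0 ≤ η)
    (hmom : ∀ r, r ≤ t + 2 * m + 1 →
      |nbExp G w₀ n (fun w => ((visitCount w u).choose r : ℝ)) - 1 / r !| ≤ η / r !) :
    (Real.exp (-1) - 2 / (2 * m + 1)! - 3 * η) / t !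
      ≤ nbExp G w₀ n (fun w => if visitCount w u = t then 1 else 0) := by
  have h1 : nbExp G w₀ n (fun w => altTrunc (2 * m + 2) t (visitCount w u))
      ≤ nbExp G w₀ n (fun w => if visitCount w u = t then 1 else 0) :=
    nbExp_mono fun w => altTrunc_le_indicator m t _
  refine le_trans ?_ h1
  simp only [altTrunc, nbExp_sum]
  have h2 : ∀ j ∈ Finset.range (2 * m + 2), (-1) ^ j / (j ! : ℝ) / (t ! : ℝ) - η * (1 / (j ! : ℝ)) / (t ! : ℝ)
      ≤ nbExp G w₀ n (fun w => (-1) ^ j * ((t + j).choose t : ℝ) *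
        (visitCount w u).choose (t + j)) := by
    intro j hj
    have hj' := Finset.mem_range.1 hj
    refine le_trans (le_of_eq ?_) (nbExp_neg_pow_mul (hmom (t + j) (by omega))).1
    have e := choose_div_factorial t j
    rw [abs_mul, abs_pow, abs_neg, abs_one, one_pow, one_mul, Nat.abs_cast]
    have e1 : (-1) ^ j * ((t + j).choose t : ℝ) * (1 / (t + j)!)
        - ((t + j).choose t : ℝ) * (η / (t + j)!)
        = ((-1) ^ j - η) * (((t + j).choose t : ℝ) / (t + j)!) := by ring
    rw [e1, e]
    field_simp
  refine le_trans ?_ (Finset.sum_le_sum h2)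
  rw [Finset.sum_sub_distrib, ← Finset.sum_div, ← Finset.sum_div, ← Finset.mul_sum, ← sub_div]
  have h3 := abs_sum_alternating_sub_exp_le (J := 2 * m + 2) (by omega)
  have h4 := sum_inv_factorial_le (2 * m + 2)
  have h5 : (2 : ℝ) / (2 * m + 2)! ≤ 2 / (2 * m + 1)! := by
    gcongr
    omega
  refine div_le_div_of_nonneg_right ?_ (by positivity)
  have h6 := (abs_le.1 h3).1
  have h7 := mul_le_mul_of_nonneg_left h4 hη
  linarith

/-- Upper truncations may be multiplied because the indicators are nonnegative. The error `9 * η` is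
`η` times the square of the bound 3 for `∑ 1 / j !`. -/
theorem nbExp_visited_pair_le {w₀ u v : V} {n t m : ℕ} {η : ℝ} (hη : 0 ≤ η)
    (hmom : ∀ r s, r ≤ t + 2 * m + 1 → s ≤ t + 2 * m + 1 →
      |nbExp G w₀ n (fun w => ((visitCount w u).choose r : ℝ) * (visitCount w v).choose s)
        - 1 / (r ! * s !)| ≤ η / (r ! * s !)) :
    nbExp G w₀ n (fun w => (if visitCount w u = t then 1 else 0) *
        (if visitCount w v = t then 1 else 0))
      ≤ ((Real.exp (-1) + 2 / (2 * m + 1)!) ^ 2 + 9 * η) / (t ! : ℝ) ^ 2 := by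
  have h1 : nbExp G w₀ n (fun w => (if visitCount w u = t then 1 else 0) *
        (if visitCount w v = t then 1 else 0))
      ≤ nbExp G w₀ n (fun w => altTrunc (2 * m + 1) t (visitCount w u) *
        altTrunc (2 * m + 1) t (visitCount w v)) := by
    refine nbExp_mono fun w => ?_
    have hu := indicator_le_altTrunc m t (visitCount w u)
    have hv := indicator_le_altTrunc m t (visitCount w v)
    refine mul_le_mul hu hv ?_ (le_trans ?_ hu) <;> split_ifs <;> norm_num
  refine h1.trans ?_
  simp only [altTrunc, Finset.sum_mul_sum, nbExp_sum]
  have h2 : ∀ i ∈ Finset.range (2 * m + 1), ∀ j ∈ Finset.range (2 * m + 1),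
      nbExp G w₀ n (fun w => (-1) ^ i * ((t + i).choose t : ℝ) *
        (visitCount w u).choose (t + i) * ((-1) ^ j * ((t + j).choose t : ℝ) *
        (visitCount w v).choose (t + j)))
      ≤ ((-1) ^ i / i ! * ((-1) ^ j / j !) + η * (1 / i ! * (1 / j !))) / (t ! : ℝ) ^ 2 := by
    intro i hi j hj
    have hi' := Finset.mem_range.1 hi
    have hj' := Finset.mem_range.1 hj
    have h3 := (nbExp_neg_pow_mul (a := (-1) ^ i * ((t + i).choose t : ℝ) *
      ((-1) ^ j * ((t + j).choose t : ℝ))) (hmom (t + i) (t + j) (by omega) (by omega))).2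
    refine le_trans (le_of_eq ?_) (h3.trans (le_of_eq ?_))
    · congr 1
      funext w
      ring
    · have ei := choose_div_factorial t i
      have ej := choose_div_factorial t j
      simp only [abs_mul, abs_pow, abs_neg, abs_one, one_pow, one_mul, Nat.abs_cast]
      have e1 : (-1) ^ i * ((t + i).choose t : ℝ) * ((-1) ^ j * ((t + j).choose t : ℝ)) *
            (1 / ((t + i)! * (t + j)!))
          + ((t + i).choose t : ℝ) * ((t + j).choose t : ℝ) * (η / ((t + i)! * (t + j)!))
          = ((-1) ^ i * (-1) ^ j + η) * (((t + i).choose t : ℝ) / (t + i)!)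
            * (((t + j).choose t : ℝ) / (t + j)!) := by field_simp
      rw [e1, ei, ej]
      field_simp
  refine (Finset.sum_le_sum fun i hi => Finset.sum_le_sum (h2 i hi)).trans ?_
  simp only [← Finset.sum_div, Finset.sum_add_distrib, ← Finset.mul_sum, ← Finset.sum_mul]
  have h3 := abs_sum_alternating_sub_exp_le (J := 2 * m + 1) (by omega)
  have h4 := sum_inv_factorial_le (2 * m + 1)
  have h5 : (0 : ℝ) ≤ ∑ j ∈ Finset.range (2 * m + 1), (1 : ℝ) / j ! :=
    Finset.sum_nonneg fun j _ => by positivity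
  have h6 : |∑ j ∈ Finset.range (2 * m + 1), (-1 : ℝ) ^ j / j !|
      ≤ Real.exp (-1) + 2 / (2 * m + 1)! := by
    have := abs_add_le (∑ j ∈ Finset.range (2 * m + 1), (-1 : ℝ) ^ j / (j ! : ℝ) - Real.exp (-1))
      (Real.exp (-1))
    rw [sub_add_cancel, abs_of_pos (Real.exp_pos _)] at this
    linarith
  have h7 := sq_le_sq' (by linarith [(abs_le.1 h6).1]) (abs_le.1 h6).2
  have h8 := mul_le_mul_of_nonneg_left (mul_le_mul h4 h4 h5 (by norm_num)) hη
  refine div_le_div_of_nonneg_right ?_ (by positivity)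
  linarith

end Sieve

/-! ### Uniform relative precision of the moments -/

section Moments

variable {V : Type*} [Fintype V] [DecidableEq V] {G : SimpleGraph V} [DecidableRel G.Adj]
  {d : ℕ}

theorem nbExp_le_of_front (hreg : G.IsRegularOfDegree d) (hd : 3 ≤ d) (w₀ u v : V)
    (r s : ℕ) {n : ℕ} (hn : 0 < n) (B : ℝ)
    (h : ∀ p, G.Adj w₀ p → nbMoment G d u v r s n p w₀ ≤ B) :
    nbExp G w₀ n (fun w => ((visitCount w u).choose r : ℝ) * (visitCount w v).choose s) ≤ B := by
  have hd' : (3 : ℝ) ≤ d := by exact_mod_cast hd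
  have hc : ((G.neighborFinset w₀).card : ℝ) = d := by
    rw [G.card_neighborFinset_eq_degree, hreg w₀]
  rw [nbExp_visitCount hreg hd w₀ u v (fun a b => (a.choose r : ℝ) * b.choose s) hn,
    div_le_iff₀ (by linarith), mul_comm, ← hc, ← nsmul_eq_mul]
  exact Finset.sum_le_card_nsmul _ _ _ fun p hp => h p ((G.mem_neighborFinset w₀ p).1 hp)

theorem le_nbExp_of_front (hreg : G.IsRegularOfDegree d) (hd : 3 ≤ d) (w₀ u v : V)
    (r s : ℕ) {n : ℕ} (hn : 0 < n) (B : ℝ)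
    (h : ∀ p, G.Adj w₀ p → B ≤ nbMoment G d u v r s n p w₀) :
    B ≤ nbExp G w₀ n
      (fun w => ((visitCount w u).choose r : ℝ) * (visitCount w v).choose s) := by
  have hd' : (3 : ℝ) ≤ d := by exact_mod_cast hd
  have hc : ((G.neighborFinset w₀).card : ℝ) = d := by
    rw [G.card_neighborFinset_eq_degree, hreg w₀]
  rw [nbExp_visitCount hreg hd w₀ u v (fun a b => (a.choose r : ℝ) * b.choose s) hn,
    le_div_iff₀ (by linarith), mul_comm, ← hc, ← nsmul_eq_mul]
  exact Finset.card_nsmul_le_sum _ _ _ fun p hp => h p ((G.mem_neighborFinset w₀ p).1 hp)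

/-- The quantitative hypotheses under which the visit counts are compared with Poisson variables:
after `M` steps the walk is mixed, short cycles are longer than `2 h`, and moments of order up to
`R` are controlled with relative precision `η`. -/
structure MomentSetup (G : SimpleGraph V) [DecidableRel G.Adj] (d n h M R : ℕ) (η : ℝ) :
    Prop where
  regular : G.IsRegularOfDegree d
  three_le : 3 ≤ d
  n_pos : 0 < n
  M_pos : 0 < M
  girth : 2 * h < G.girth
  mixing : ∀ (y : V) (k : ℕ) (p x : V), M ≤ k → G.Adj x p →
    |nbHit G d y k p x - 1 / n| ≤ 1 / (n : ℝ) ^ 2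
  η_nonneg : 0 ≤ η
  η_le : η ≤ 1
  upper : (R : ℝ) * (1 / n + R * (M * (1 / ((d : ℝ) - 1)) ^ h)) ≤ η / 2
  lower : (R : ℝ) * ((1 + R * M) / n) ≤ η
  lower_one : (1 + (R : ℝ) * M) / n ≤ 1

variable {n h M R : ℕ} {η : ℝ}

theorem pow_le_one_add_of_mul_le {x η : ℝ} {m : ℕ} (hx : 0 ≤ x) (hη : η ≤ 1)
    (h : m * x ≤ η / 2) : (1 + x) ^ m ≤ 1 + η := by
  have h1 : (1 + x) ^ m ≤ Real.exp (m * x) := by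
    rw [Real.exp_nat_mul]
    gcongr
    linarith [Real.add_one_le_exp x]
  have h0 : 0 ≤ m * x := by positivity
  have h2 := Real.exp_bound_div_one_sub_of_interval h0 (by linarith)
  refine h1.trans (h2.trans ?_)
  rw [div_le_iff₀ (by linarith)]
  nlinarith

theorem MomentSetup.base_le (hS : MomentSetup G d n h M R η) {m : ℕ} (hm : m ≤ R) {q : ℕ}
    (hq : q ≤ R) :
    ((1 + 1 / (n : ℝ)) / n * n + q * (M * (1 / ((d : ℝ) - 1)) ^ h)) ^ m ≤ 1 + η := by
  have hn : (0 : ℝ) < n := by exact_mod_cast hS.n_pos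
  have hd' : (3 : ℝ) ≤ d := by exact_mod_cast hS.three_le
  have hd1 : (0 : ℝ) < (d : ℝ) - 1 := by linarith
  have hm' : (m : ℝ) ≤ R := by exact_mod_cast hm
  have hq' : (q : ℝ) ≤ R := by exact_mod_cast hq
  rw [div_mul_cancel₀ _ hn.ne', add_assoc]
  refine pow_le_one_add_of_mul_le (by positivity) hS.η_le (le_trans ?_ hS.upper)
  gcongr

theorem MomentSetup.le_c (hS : MomentSetup G d n h M R η) (y : V) (k : ℕ) (p x : V)
    (hk : M ≤ k) (hxp : G.Adj x p) : nbHit G d y k p x ≤ (1 + 1 / (n : ℝ)) / n := by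
  have hn : (0 : ℝ) < n := by exact_mod_cast hS.n_pos
  have := (abs_le.1 (hS.mixing y k p x hk hxp)).2
  have e : (1 + 1 / (n : ℝ)) / n = 1 / n + 1 / (n : ℝ) ^ 2 := by field_simp
  linarith

theorem MomentSetup.c_le (hS : MomentSetup G d n h M R η) (y : V) (k : ℕ) (p x : V)
    (hk : M ≤ k) (hxp : G.Adj x p) : (1 - 1 / (n : ℝ)) / n ≤ nbHit G d y k p x := by
  have hn : (0 : ℝ) < n := by exact_mod_cast hS.n_pos
  have := (abs_le.1 (hS.mixing y k p x hk hxp)).1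
  have e : (1 - 1 / (n : ℝ)) / n = 1 / n - 1 / (n : ℝ) ^ 2 := by field_simp
  linarith

theorem MomentSetup.hit_le (hS : MomentSetup G d n h M R η) {u v x : V}
    (hx : (x = u ∨ ¬ IsNear G h x u) ∧ (x = v ∨ ¬ IsNear G h x v)) (p : V) (k : ℕ)
    (hxp : G.Adj x p) (hk : 1 ≤ k) :
    nbHit G d u k p x ≤ (1 / ((d : ℝ) - 1)) ^ h ∧ nbHit G d v k p x ≤ (1 / ((d : ℝ) - 1)) ^ h :=
  ⟨nbHit_le_of_not_isNear hS.regular hS.three_le hS.girth hx.1 k hk p hxp,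
    nbHit_le_of_not_isNear hS.regular hS.three_le hS.girth hx.2 k hk p hxp⟩

/-- The set of admissible starts consists of the vertices that are equal to or far from `u`, and
likewise for `v`; the distance hypotheses put `u`, `v` and `w₀` into it. The lower bound ends with
Bernoulli's inequality. -/
theorem MomentSetup.abs_moment_sub_le (hS : MomentSetup G d n h M R η) {w₀ u v : V}
    (huv : u ≠ v) (hfar : ¬ IsNear G h u v) (hu : ¬ IsNear G h w₀ u) (hv : ¬ IsNear G h w₀ v)
    {r s : ℕ} (hrs : r + s ≤ R) :
    |nbExp G w₀ n (fun w => ((visitCount w u).choose r : ℝ) * (visitCount w v).choose s)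
        - 1 / (r ! * s !)| ≤ η / (r ! * s !) := by
  have hn : (0 : ℝ) < n := by exact_mod_cast hS.n_pos
  have hn1 : (1 : ℝ) ≤ n := by exact_mod_cast hS.n_pos
  have hd' : (3 : ℝ) ≤ d := by exact_mod_cast hS.three_le
  have hd1 : (0 : ℝ) < (d : ℝ) - 1 := by linarith
  have hc0 : 0 ≤ (1 - 1 / (n : ℝ)) / n := by
    have : 1 / (n : ℝ) ≤ 1 := (div_le_one hn).2 hn1
    exact div_nonneg (by linarith) hn.le
  have hup : nbExp G w₀ n (fun w => ((visitCount w u).choose r : ℝ) * (visitCount w v).choose s)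
      ≤ (1 + η) / (r ! * s !) := by
    refine nbExp_le_of_front hS.regular hS.three_le w₀ u v r s hS.n_pos _ fun p hp => ?_
    refine (nbMoment_le hS.regular hS.three_le huv (c := (1 + 1 / (n : ℝ)) / n)
      (β := (1 / ((d : ℝ) - 1)) ^ h) (by positivity) (by positivity) hS.le_c
      (fun x => (x = u ∨ ¬ IsNear G h x u) ∧ (x = v ∨ ¬ IsNear G h x v))
      ⟨Or.inl rfl, Or.inr hfar⟩ ⟨Or.inr fun hh => hfar hh.symm, Or.inl rfl⟩
      (fun x hx p k => hS.hit_le hx p k) (r + s) r s rfl n p w₀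
      ⟨Or.inr hu, Or.inr hv⟩ hp).trans ?_
    gcongr
    exact hS.base_le hrs hrs
  have hlow : (1 - η) / (r ! * s !) ≤ nbExp G w₀ n
      (fun w => ((visitCount w u).choose r : ℝ) * (visitCount w v).choose s) := by
    refine le_nbExp_of_front hS.regular hS.three_le w₀ u v r s hS.n_pos _ fun p hp => ?_
    refine le_trans ?_ (le_nbMoment hS.regular hS.three_le huv hc0 hS.M_pos hS.c_le
      (r + s) r s rfl n p w₀ hp)
    gcongr
    have hm : ((r + s : ℕ) : ℝ) ≤ R := by exact_mod_cast hrs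
    set m := r + s with hmdef
    set x : ℝ := (1 + R * M) / n with hx
    have hx0 : 0 ≤ x := by positivity
    have h1 : 1 - x ≤ (1 - 1 / (n : ℝ)) / n * n - (1 - 1 / (n : ℝ)) / n * (m * M) := by
      rw [div_mul_cancel₀ _ hn.ne']
      have h2 : (1 - 1 / (n : ℝ)) / n * (m * M) ≤ 1 / n * (R * M) := by
        gcongr
        have : 0 < 1 / (n : ℝ) := by positivity
        linarith
      have h3 : x = 1 / n + 1 / n * (R * M) := by rw [hx]; ring
      linarith
    have h2 : (1 - x) ^ m ≤ max 0 ((1 - 1 / (n : ℝ)) / n * n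
        - (1 - 1 / (n : ℝ)) / n * (m * M)) ^ m := by
      have hx1 : x ≤ 1 := hS.lower_one
      exact pow_le_pow_left₀ (by linarith) (h1.trans (le_max_right _ _)) m
    refine le_trans ?_ h2
    have h3 := one_add_mul_le_pow (a := -x) (by linarith [hS.lower_one]) m
    have h4 : (m : ℝ) * x ≤ η := le_trans (by gcongr) hS.lower
    rw [← sub_eq_add_neg] at h3
    linarith
  rw [abs_le]
  rw [add_div] at hup
  rw [sub_div] at hlow
  constructor <;> linarith

/-- A crude bound without condition on `w₀`; its loss is a product of `M` and `R`, polylogarithmic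
in the application. The vertex `v` only completes the two-target moment, taken with `s = 0`. -/
theorem MomentSetup.moment_le (hS : MomentSetup G d n h M R η) {w₀ u v : V}
    (huv : u ≠ v) (hfar : ¬ IsNear G h u v) {r : ℕ} (hr : r ≤ R) :
    nbExp G w₀ n (fun w => ((visitCount w u).choose r : ℝ)) ≤ (1 + 2 * (M + 2) * R) / r ! := by
  rcases r with - | r
  · simp only [Nat.choose_zero_right, Nat.cast_one, nbExp_const hS.regular hS.three_le,
      Nat.factorial_zero, div_one]
    have : (0 : ℝ) ≤ 2 * (M + 2) * R := by positivity
    linarith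
  have hn : (0 : ℝ) < n := by exact_mod_cast hS.n_pos
  have hn1 : (1 : ℝ) ≤ n := by exact_mod_cast hS.n_pos
  have hd' : (3 : ℝ) ≤ d := by exact_mod_cast hS.three_le
  have hd1 : (0 : ℝ) < (d : ℝ) - 1 := by linarith
  have h0 := nbExp_le_of_front hS.regular hS.three_le w₀ u v (r + 1) 0 hS.n_pos
    ((1 + 2 * (M + 2) * R) / (r + 1)!) fun p hp => ?_
  · simpa using h0
  refine (nbMoment_le_of_start hS.regular hS.three_le huv (c := (1 + 1 / (n : ℝ)) / n)
      (β := (1 / ((d : ℝ) - 1)) ^ h) (by positivity) (by positivity) hS.le_c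
      (fun x => (x = u ∨ ¬ IsNear G h x u) ∧ (x = v ∨ ¬ IsNear G h x v))
      ⟨Or.inl rfl, Or.inr hfar⟩ ⟨Or.inr fun hh => hfar hh.symm, Or.inl rfl⟩
      (fun x hx p k => hS.hit_le hx p k) r n p w₀ hp).trans ?_
  have h1 := hS.base_le (show r ≤ R by omega) (show r ≤ R by omega)
  have h2 : (1 + 1 / (n : ℝ)) / n * n ≤ 2 := by
    rw [div_mul_cancel₀ _ hn.ne']
    have : 1 / (n : ℝ) ≤ 1 := (div_le_one hn).2 hn1
    linarith
  have hr' : ((r + 1 : ℕ) : ℝ) ≤ R := by exact_mod_cast hr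
  rw [← mul_div_assoc, div_le_div_iff₀ (by positivity) (by positivity), Nat.factorial_succ]
  calc _ ≤ (2 + (M : ℝ)) * (1 + 1) * ((r + 1 : ℕ) * r ! : ℕ) := by
        gcongr
        exact h1.trans (by linarith [hS.η_le])
    _ = 2 * (M + 2) * (r + 1 : ℕ) * r ! := by push_cast; ring
    _ ≤ 2 * (M + 2) * R * r ! := by gcongr
    _ ≤ _ := by gcongr; linarith

end Moments

/-! ### Second moment method and union bound -/

section SecondMoment

variable {V : Type*} [Fintype V] [DecidableEq V] {G : SimpleGraph V} [DecidableRel G.Adj]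
  {d n h M R : ℕ} {η : ℝ}

theorem visitedExactly_eq_sum {k : ℕ} (w : Fin (k + 1) → V) (t : ℕ) :
    (visitedExactly w t : ℝ) = ∑ u : V, if visitCount w u = t then (1 : ℝ) else 0 := by
  rw [visitedExactly, Finset.card_filter]
  push_cast
  rfl

theorem MomentSetup.exists_far (hS : MomentSetup G d n h M R η) (hcard : Fintype.card V = n)
    (hB : 2 * d ^ h < n) (x y : V) : ∃ v, ¬ IsNear G h x v ∧ ¬ IsNear G h y v := by
  classical
  by_contra hcon
  push Not at hcon
  have hsub : (Finset.univ : Finset V) ⊆ (Finset.univ.filter fun v => IsNear G h x v) ∪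
      Finset.univ.filter fun v => IsNear G h y v := by
    intro v _
    rw [Finset.mem_union, Finset.mem_filter, Finset.mem_filter]
    by_cases hx : IsNear G h x v
    · exact Or.inl ⟨Finset.mem_univ _, hx⟩
    · exact Or.inr ⟨Finset.mem_univ _, hcon v hx⟩
  have h1 := (Finset.card_le_card hsub).trans (Finset.card_union_le _ _)
  rw [Finset.card_univ, hcard] at h1
  have h2 := card_isNear_le hS.regular hS.three_le h x
  have h3 := card_isNear_le hS.regular hS.three_le h y
  omega

theorem ne_of_not_isNear {V : Type*} {G : SimpleGraph V} {h : ℕ} (hh : 0 < h) {x y : V}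
    (hxy : ¬ IsNear G h x y) : x ≠ y := by
  rintro rfl
  exact hxy ⟨.nil, hh⟩

theorem MomentSetup.visited_ge (hS : MomentSetup G d n h M R η) (hcard : Fintype.card V = n)
    (hh : 0 < h) (hB : 2 * d ^ h < n) {w₀ u : V} (hu : ¬ IsNear G h w₀ u) {t m : ℕ}
    (ht : 2 * (t + 2 * m + 1) ≤ R) :
    (Real.exp (-1) - 2 / (2 * m + 1)! - 3 * η) / t !
      ≤ nbExp G w₀ n (fun w => if visitCount w u = t then 1 else 0) := by
  obtain ⟨v, hv, huv⟩ := hS.exists_far hcard hB w₀ u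
  refine nbExp_visited_ge hS.η_nonneg fun r hr => ?_
  have := hS.abs_moment_sub_le (ne_of_not_isNear hh huv) huv hu hv (r := r) (s := 0) (by omega)
  simpa using this

theorem MomentSetup.visited_le (hS : MomentSetup G d n h M R η) (hcard : Fintype.card V = n)
    (hh : 0 < h) (hB : 2 * d ^ h < n) (w₀ u : V) {t : ℕ} (ht : t ≤ R) :
    nbExp G w₀ n (fun w => ((visitCount w u).choose t : ℝ)) ≤ (1 + 2 * (M + 2) * R) / t ! := by
  obtain ⟨v, -, huv⟩ := hS.exists_far hcard hB w₀ u
  exact hS.moment_le (ne_of_not_isNear hh huv) huv ht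

theorem MomentSetup.first_moment_ge (hS : MomentSetup G d n h M R η)
    (hcard : Fintype.card V = n) (hh : 0 < h) (hB : 2 * d ^ h < n) (w₀ : V) {t m : ℕ}
    (ht : 2 * (t + 2 * m + 1) ≤ R) (hpos : 0 ≤ Real.exp (-1) - 2 / (2 * m + 1)! - 3 * η) :
    ((n : ℝ) - d ^ h) * ((Real.exp (-1) - 2 / (2 * m + 1)! - 3 * η) / t !)
      ≤ nbExp G w₀ n (fun w => (visitedExactly w t : ℝ)) := by
  classical
  simp only [visitedExactly_eq_sum, nbExp_sum]
  set S := Finset.univ.filter fun u => ¬ IsNear G h w₀ u with hSdef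
  have h1 : (n : ℝ) - d ^ h ≤ S.card := by
    have h2 : (Finset.univ.filter fun u => IsNear G h w₀ u).card + S.card
        = (Finset.univ : Finset V).card := by
      rw [hSdef]
      convert Finset.card_filter_add_card_filter_not (s := (Finset.univ : Finset V))
        (fun u => IsNear G h w₀ u)
    have h3 := card_isNear_le hS.regular hS.three_le h w₀
    rw [Finset.card_univ, hcard] at h2
    have h4 : n ≤ d ^ h + S.card := by omega
    have h5 : (n : ℝ) ≤ d ^ h + S.card := by exact_mod_cast h4
    linarith
  calc _ ≤ (S.card : ℝ) * ((Real.exp (-1) - 2 / (2 * m + 1)! - 3 * η) / t !) := by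
        refine mul_le_mul_of_nonneg_right h1 (div_nonneg hpos (by positivity))
    _ ≤ ∑ u ∈ S, nbExp G w₀ n (fun w => if visitCount w u = t then 1 else 0) := by
        rw [← nsmul_eq_mul]
        exact Finset.card_nsmul_le_sum _ _ _ fun u hu =>
          hS.visited_ge hcard hh hB (Finset.mem_filter.1 hu).2 ht
    _ ≤ _ := Finset.sum_le_sum_of_subset_of_nonneg (Finset.subset_univ _) fun u _ _ =>
        Finset.sum_nonneg fun w _ => mul_nonneg (nbWalkProb_nonneg _ _ _) (by dsimp only; split_ifs <;> simp)

/-- Pairs far from the start and from each other satisfy the Poisson bound. The others, diagonal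
included since `h > 0`, number at most `3 * n * d ^ h`; for them the joint indicator is at most
`(visitCount w u).choose t`. -/
theorem MomentSetup.second_moment_le (hS : MomentSetup G d n h M R η)
    (hcard : Fintype.card V = n) (hh : 0 < h) (hB : 2 * d ^ h < n) (w₀ : V) {t m : ℕ}
    (ht : 2 * (t + 2 * m + 1) ≤ R) :
    nbExp G w₀ n (fun w => (visitedExactly w t : ℝ) ^ 2)
      ≤ (n : ℝ) ^ 2 * (((Real.exp (-1) + 2 / (2 * m + 1)!) ^ 2 + 9 * η) / (t ! : ℝ) ^ 2)
        + 3 * n * d ^ h * ((1 + 2 * (M + 2) * R) / t !) := by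
  classical
  simp only [visitedExactly_eq_sum, sq, Finset.sum_mul_sum, nbExp_sum]
  have hη := hS.η_nonneg
  set P := ((Real.exp (-1) + 2 / (2 * m + 1)!) * (Real.exp (-1) + 2 / (2 * m + 1)!) + 9 * η) /
    ((t ! : ℝ) * t !) with hP
  set Q := (1 + 2 * ((M : ℝ) + 2) * R) / t ! with hQ
  have hP0 : 0 ≤ P := by
    refine div_nonneg (add_nonneg (mul_self_nonneg _) (by positivity)) (by positivity)
  have hQ0 : 0 ≤ Q := by positivity
  have hle : ∀ u v, nbExp G w₀ n (fun w => (if visitCount w u = t then 1 else 0) *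
      (if visitCount w v = t then 1 else 0))
      ≤ P + ((if IsNear G h w₀ u then Q else 0) + (if IsNear G h w₀ v then Q else 0)
        + if IsNear G h u v then Q else 0) := by
    intro u v
    by_cases hall : ¬ IsNear G h w₀ u ∧ ¬ IsNear G h w₀ v ∧ ¬ IsNear G h u v
    · rw [if_neg hall.1, if_neg hall.2.1, if_neg hall.2.2]
      have := nbExp_visited_pair_le (w₀ := w₀) (u := u) (v := v) (n := n) (t := t) (m := m) hη
        fun r s hr hs => hS.abs_moment_sub_le (ne_of_not_isNear hh hall.2.2) hall.2.2 hall.1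
          hall.2.1 (by omega)
      rw [sq, sq] at this
      linarith
    · have h1 : nbExp G w₀ n (fun w => (if visitCount w u = t then 1 else 0) *
          (if visitCount w v = t then 1 else 0)) ≤ Q := by
        refine le_trans (nbExp_mono fun w => ?_) (hS.visited_le hcard hh hB w₀ u (t := t) (by omega))
        by_cases hX : visitCount w u = t
        · rw [if_pos hX, hX, Nat.choose_self]
          split_ifs <;> norm_num
        · rw [if_neg hX, zero_mul]
          positivity
      have h2 : Q ≤ (if IsNear G h w₀ u then Q else 0) + (if IsNear G h w₀ v then Q else 0)
        + if IsNear G h u v then Q else 0 := by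
        by_cases a : IsNear G h w₀ u <;> by_cases b : IsNear G h w₀ v <;>
          by_cases c : IsNear G h u v <;> simp only [a, b, c, if_true, if_false] <;>
          first | linarith | exact absurd ⟨a, b, c⟩ hall
      linarith
  have hnear : ∀ x, ∑ v, (if IsNear G h x v then Q else 0) ≤ d ^ h * Q := by
    intro x
    rw [← Finset.sum_filter, Finset.sum_const, nsmul_eq_mul]
    gcongr
    exact_mod_cast card_isNear_le hS.regular hS.three_le h x
  refine (Finset.sum_le_sum fun u _ => Finset.sum_le_sum fun v _ => hle u v).trans ?_
  simp only [Finset.sum_add_distrib, Finset.sum_const, Finset.card_univ, hcard, nsmul_eq_mul]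
  rw [← Finset.mul_sum]
  have h1 := mul_le_mul_of_nonneg_left (hnear w₀) (Nat.cast_nonneg (α := ℝ) n)
  have h2 := Finset.sum_le_card_nsmul Finset.univ
    (fun u => ∑ v, (if IsNear G h u v then Q else 0)) _ fun u _ => hnear u
  rw [Finset.card_univ, hcard, nsmul_eq_mul] at h2
  linarith

/-- The normalised second moment of the number of vertices visited `t` times. -/
theorem MomentSetup.variance_le (hS : MomentSetup G d n h M R η)
    (hcard : Fintype.card V = n) (hh : 0 < h) (hB : 2 * d ^ h < n) (w₀ : V) {t m : ℕ}
    (ht : 2 * (t + 2 * m + 1) ≤ R) {τ : ℝ} (hτ : (2 : ℝ) / (2 * m + 1)! ≤ τ) (hτ1 : τ ≤ 1)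
    (hpos : τ + 3 * η ≤ 1 / 3) :
    nbExp G w₀ n
        (fun w => ((visitedExactly w t : ℝ) / ((n : ℝ) / (Real.exp 1 * (t ! : ℝ))) - 1) ^ 2)
      ≤ 21 * τ + 99 * η + 27 * d ^ h * (1 + 2 * (M + 2) * R) * (t ! / n) + 2 * (d ^ h / n) := by
  have hn : (0 : ℝ) < n := by exact_mod_cast hS.n_pos
  have hη := hS.η_nonneg
  set e := Real.exp 1 with he
  have he0 : 0 < e := Real.exp_pos _
  have he3 : e ≤ 3 := by linarith [Real.exp_one_lt_d9]
  set σ : ℝ := 2 / (2 * m + 1)! with hσ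
  have hσ0 : 0 ≤ σ := by positivity
  have heq : Real.exp (-1) = 1 / e := by rw [Real.exp_neg, one_div]
  have h13 : 1 / 3 ≤ 1 / e := one_div_le_one_div_of_le he0 he3
  set T : ℝ := (t ! : ℝ) with hT
  have hT0 : 0 < T := by positivity
  -- In the expanded square the first moment has a negative coefficient, so a lower bound for it and
  -- an upper bound for the second moment suffice.
  have hexp : ∀ w : Fin (n + 1) → V, ((visitedExactly w t : ℝ) / ((n : ℝ) / (e * T)) - 1) ^ 2
      = (e * T / n) ^ 2 * (visitedExactly w t : ℝ) ^ 2
        + ((-(2 * (e * T / n))) * (visitedExactly w t : ℝ) + 1) := by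
    intro w
    field_simp
    ring
  simp only [hexp, nbExp_add, nbExp_const_mul, nbExp_const hS.regular hS.three_le]
  have hfirst := hS.first_moment_ge hcard hh hB w₀ ht
    (by rw [heq]; linarith)
  have hsecond := hS.second_moment_le hcard hh hB w₀ ht
  rw [heq] at hfirst hsecond
  set D : ℝ := (d : ℝ) ^ h with hD
  have hD0 : 0 ≤ D := by positivity
  have hDn : D / n ≤ 1 := by
    rw [div_le_one hn]
    have : ((2 * d ^ h : ℕ) : ℝ) < n := by exact_mod_cast hB
    push_cast at this
    linarith
  set Q : ℝ := 1 + 2 * ((M : ℝ) + 2) * R with hQ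
  have hQ0 : 0 ≤ Q := by positivity
  have h1 := mul_le_mul_of_nonneg_left hsecond (sq_nonneg (e * T / n))
  have h2 := mul_le_mul_of_nonneg_left hfirst (show 0 ≤ 2 * (e * T / n) by positivity)
  have e1 : (e * T / n) ^ 2 * ((n : ℝ) ^ 2 * (((1 / e + σ) ^ 2 + 9 * η) / T ^ 2)
      + 3 * n * D * (Q / T)) = (1 + e * σ) ^ 2 + 9 * e ^ 2 * η + 3 * e ^ 2 * (D * Q * (T / n)) := by
    field_simp
  have e2 : 2 * (e * T / n) * (((n : ℝ) - D) * ((1 / e - σ - 3 * η) / T))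
      = 2 * (1 - D / n) * (1 - e * σ - 3 * e * η) := by
    field_simp
  rw [e1] at h1
  rw [e2] at h2
  have h3 : e * σ ≤ 3 * τ := mul_le_mul he3 hτ hσ0 (by norm_num)
  have h4 : 0 ≤ e * σ := by positivity
  have h5 : e ^ 2 ≤ 9 := by nlinarith
  have h6 : 9 * e ^ 2 * η ≤ 81 * η := by nlinarith
  have h7 : 3 * e ^ 2 * (D * Q * (T / n)) ≤ 27 * (D * Q * (T / n)) := by
    refine mul_le_mul_of_nonneg_right (by linarith) (by positivity)
  have h8 : e * η ≤ 3 * η := by gcongr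
  have h9 : 0 ≤ D / n := by positivity
  have h10 : 0 ≤ e * η := by positivity
  have h11 : 2 * (1 - D / n) * (1 - e * σ - 3 * e * η)
      ≥ 2 - 2 * (e * σ) - 6 * (e * η) - 2 * (D / n) := by
    have := mul_nonneg h9 (show 0 ≤ e * σ + 3 * (e * η) by positivity)
    generalize D / n = x at *
    linarith
  have h12 : (e * σ) ^ 2 ≤ 9 * τ := by
    have hτ0 : 0 ≤ τ := hσ0.trans hτ
    calc (e * σ) ^ 2 ≤ (3 * τ) ^ 2 := by gcongr
      _ = 9 * (τ * τ) := by ring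
      _ ≤ 9 * (τ * 1) := by gcongr
      _ = 9 * τ := by ring
  have h13 : 27 * D * Q * (T / n) = 27 * (D * Q * (T / n)) := by ring
  have h14 : (1 + e * σ) ^ 2 = 1 + 2 * (e * σ) + (e * σ) ^ 2 := by ring
  rw [h13]
  rw [h14] at h1
  linarith

theorem nbProb_ge_of_indicator (hreg : G.IsRegularOfDegree d) (hd : 3 ≤ d) (w₀ : V) (k : ℕ)
    (E : Set (Fin (k + 1) → V)) (Φ : (Fin (k + 1) → V) → ℝ) (h0 : ∀ w, 0 ≤ Φ w)
    (h1 : ∀ w, w ∉ E → 1 ≤ Φ w) : 1 - nbExp G w₀ k Φ ≤ nbProb G w₀ k E := by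
  classical
  rw [← nbExp_const (G := G) hreg hd w₀ k 1, nbExp, nbExp, ← Finset.sum_sub_distrib, nbProb]
  refine Finset.sum_le_sum fun w _ => ?_
  have hp := nbWalkProb_nonneg (G := G) w₀ k w
  split_ifs with hw
  · have := mul_nonneg hp (h0 w)
    linarith
  · have := mul_le_mul_of_nonneg_left (h1 w hw) hp
    linarith

/-- A union bound over the numbers of visits: all the `N_t` with `t ∈ S` are near to their Poisson
values, and no vertex is visited `T` times. -/
theorem MomentSetup.nbProb_ge (hS : MomentSetup G d n h M R η)
    (hcard : Fintype.card V = n) (hh : 0 < h) (hB : 2 * d ^ h < n) (w₀ : V) {m T : ℕ}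
    (S : Finset ℕ) (ht : ∀ t ∈ S, 2 * (t + 2 * m + 1) ≤ R) (hT : T ≤ R)
    {τ : ℝ} (hτ : (2 : ℝ) / (2 * m + 1)! ≤ τ) (hτ1 : τ ≤ 1) (hpos : τ + 3 * η ≤ 1 / 3)
    {a v : ℝ} (ha : 0 < a)
    (hv : ∀ t ∈ S, 21 * τ + 99 * η + 27 * d ^ h * (1 + 2 * (M + 2) * R) * (t ! / n)
      + 2 * (d ^ h / n) ≤ v)
    (E : Set (Fin (n + 1) → V))
    (hE : ∀ w, w ∉ E → (∃ t ∈ S,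
      a < |(visitedExactly w t : ℝ) / ((n : ℝ) / (Real.exp 1 * (t ! : ℝ))) - 1|)
        ∨ ∃ u, T ≤ visitCount w u) :
    1 - (S.card * (v / a ^ 2) + n * ((1 + 2 * (M + 2) * R) / T !)) ≤ nbProb G w₀ n E := by
  set Φ₁ : ℕ → (Fin (n + 1) → V) → ℝ := fun t w =>
    1 / a ^ 2 * ((visitedExactly w t : ℝ) / ((n : ℝ) / (Real.exp 1 * (t ! : ℝ))) - 1) ^ 2 with hΦ₁
  -- This is at least 1 as soon as `u` is visited `T` times or more, so one expectation handles all
  -- large visit counts.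
  set Φ₂ : V → (Fin (n + 1) → V) → ℝ := fun u w => ((visitCount w u).choose T : ℝ) with hΦ₂
  have h10 : ∀ t w, 0 ≤ Φ₁ t w := fun t w => by simp only [hΦ₁]; positivity
  have h20 : ∀ u w, 0 ≤ Φ₂ u w := fun u w => by simp only [hΦ₂]; positivity
  refine le_trans ?_ (nbProb_ge_of_indicator hS.regular hS.three_le w₀ n E
    (fun w => ∑ t ∈ S, Φ₁ t w + ∑ u, Φ₂ u w)
    (fun w => add_nonneg (Finset.sum_nonneg fun t _ => h10 t w)
      (Finset.sum_nonneg fun u _ => h20 u w)) fun w hw => ?_)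
  · rw [nbExp_add, nbExp_sum, nbExp_sum]
    have h1 : ∑ t ∈ S, nbExp G w₀ n (Φ₁ t) ≤ S.card * (v / a ^ 2) := by
      rw [← nsmul_eq_mul]
      refine Finset.sum_le_card_nsmul _ _ _ fun t htS => ?_
      simp only [hΦ₁, nbExp_const_mul]
      rw [div_eq_mul_one_div v, mul_comm v]
      gcongr
      exact (hS.variance_le hcard hh hB w₀ (ht t htS) hτ hτ1 hpos).trans (hv t htS)
    have h2 : ∑ u, nbExp G w₀ n (Φ₂ u) ≤ n * ((1 + 2 * (M + 2) * R) / T !) := by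
      have h3 := Finset.sum_le_card_nsmul Finset.univ (fun u => nbExp G w₀ n (Φ₂ u)) _
        fun u _ => hS.visited_le hcard hh hB w₀ u hT
      rwa [Finset.card_univ, hcard, nsmul_eq_mul] at h3
    linarith
  · rcases hE w hw with ⟨t, htS, hlt⟩ | ⟨u, hu⟩
    · have h1 : 1 ≤ Φ₁ t w := by
        simp only [hΦ₁]
        rw [div_mul_eq_mul_div, one_mul, one_le_div (by positivity), ← sq_abs (_ / _ - 1)]
        gcongr
      have h2 := Finset.single_le_sum (fun t _ => h10 t w) htS
      have h3 := Finset.sum_nonneg (s := Finset.univ) fun u _ => h20 u w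
      linarith
    · have h1 : 1 ≤ Φ₂ u w := by
        simp only [hΦ₂]
        exact_mod_cast Nat.choose_pos hu
      have h2 := Finset.single_le_sum (fun u _ => h20 u w) (Finset.mem_univ u)
      have h3 := Finset.sum_nonneg (s := S) fun t _ => h10 t w
      linarith

end SecondMoment

/-! ### Factorials near the threshold -/

section Threshold

open Filter in
theorem eventually_mul_log_pow_le (K : ℝ) (k : ℕ) :
    ∀ᶠ x : ℝ in atTop, K * Real.log x ^ k ≤ x := by
  have h1 := (Real.isLittleO_pow_log_id_atTop (n := k)).def (c := 1 / (|K| + 1)) (by positivity)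
  filter_upwards [h1, eventually_ge_atTop 0] with x hx hx0
  simp only [Real.norm_eq_abs, id, abs_of_nonneg hx0] at hx
  have h2 : |K * Real.log x ^ k| ≤ |K| * (1 / (|K| + 1) * x) := by
    rw [abs_mul]
    gcongr
  have h3 : |K| * (1 / (|K| + 1) * x) ≤ x := by
    rw [← mul_assoc, mul_one_div]
    refine mul_le_of_le_one_left hx0 ?_
    rw [div_le_one (by positivity)]
    linarith
  exact (le_abs_self _).trans (h2.trans h3)

/-- The logarithmic inequalities, valid for large `L`, behind the estimates of factorials near
the threshold `L / log L`. -/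
structure LogScale (δ L : ℝ) : Prop where
  δ_pos : 0 < δ
  L_ge : 2 ≤ L
  one_le : 1 ≤ Real.log (Real.log L)
  eight_le : 8 ≤ δ * Real.log (Real.log L)
  lt_log : Real.log (Real.log L) + 1 ≤ Real.log L
  small : (1 + δ) * Real.log (Real.log L) ≤ δ / 8 * Real.log L
  delta_le : 1 + δ ≤ Real.log L
  twenty_le : 20 * Real.log L ≤ L
  sq_le : 40 * Real.log L ^ 2 ≤ δ * L

namespace LogScale

variable {δ L : ℝ}

theorem main_ineqs (h : LogScale δ L) :
    ∃ l y z : ℝ, l = Real.log L ∧ 0 < l ∧ y = Real.log l / l ∧ z = 1 / l ∧ 0 ≤ z ∧ z ≤ y ∧ y ≤ 1 ∧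
      z ≤ δ * y / 8 ∧ (1 + δ) * y ≤ δ / 8 ∧ 20 * l ≤ L * (δ * y / 2) ∧ (1 + δ) * y ≤ l - 1 ∧
      Real.log (L / l) = l - Real.log l ∧ L / l * (l - Real.log l) = L * (1 - y) ∧
      L / l = L * z := by
  have h1 := h.one_le
  have h2 := h.lt_log
  have hδ := h.δ_pos
  have hL : 0 < L := by linarith [h.L_ge]
  set l := Real.log L with hl
  have hl0 : 0 < l := by linarith
  refine ⟨l, Real.log l / l, 1 / l, rfl, hl0, rfl, rfl, by positivity, ?_, ?_, ?_, ?_, ?_, ?_, ?_,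
    ?_, ?_⟩
  · gcongr
  · rw [div_le_one hl0]
    linarith
  · rw [div_le_div_iff₀ hl0 (by norm_num)]
    have := h.eight_le
    have e : δ * (Real.log l / l) * l = δ * Real.log l := by field_simp
    linarith
  · rw [← mul_div_assoc, div_le_iff₀ hl0]
    exact h.small
  · have := h.sq_le
    have e : L * (δ * (Real.log l / l) / 2) = δ * L * Real.log l / (2 * l) := by ring
    rw [e, le_div_iff₀ (by positivity)]
    have h3 : δ * L * 1 ≤ δ * L * Real.log l := by gcongr
    nlinarith
  · have h3 : (1 + δ) * (Real.log l / l) ≤ δ / 8 := by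
      rw [← mul_div_assoc, div_le_iff₀ hl0]
      exact h.small
    linarith [h.delta_le]
  · rw [Real.log_div hL.ne' hl0.ne']
  · field_simp
  · ring

/-- From t! ≤ tᵗ and t < (1 + (1 - δ) y) L / l one gets t log t ≤ L (1 + (1 - δ) y)(1 - y + z) ≤ L
(1 - δ y / 2). The terms of order y cancel except for δ y, and the margin L δ y / 2 exceeds 20 l,
the logarithm of L²⁰. -/
theorem factorial_mul_le (h : LogScale δ L) (t : ℕ)
    (ht : (t : ℝ) < (1 + (1 - δ) * (Real.log (Real.log L) / Real.log L)) * (L / Real.log L)) :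
    (t ! : ℝ) * L ^ 20 ≤ Real.exp L := by
  obtain ⟨l, y, z, hl, hl0, hy, hz, hz0, hzy, hy1, h1, h2, h3, h4, h5, h6, h7⟩ := h.main_ineqs
  have hδ := h.δ_pos
  have hL : 0 < L := by linarith [h.L_ge]
  have hL20 : L ^ 20 = Real.exp (20 * l) := by
    rw [hl, show (20 : ℝ) = (20 : ℕ) by norm_num, Real.exp_nat_mul, Real.exp_log hL]
  rw [hL20]
  rcases Nat.eq_zero_or_pos t with rfl | htpos
  · rw [Nat.factorial_zero, Nat.cast_one, one_mul, Real.exp_le_exp, hl]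
    exact h.twenty_le
  rw [← hl, ← hy] at ht
  set P := 1 + (1 - δ) * y with hP
  have ht1 : (1 : ℝ) ≤ t := by exact_mod_cast htpos
  have hLl : 0 < L / l := by positivity
  -- For large `δ` the factor could be negative; then no `t ≥ 1` lies below the threshold.
  have hP0 : 0 < P := by
    by_contra hneg
    have := mul_nonpos_of_nonpos_of_nonneg (not_lt.1 hneg) hLl.le
    linarith
  have hlogt : Real.log t ≤ l - Real.log l + 1 := by
    have h8 : Real.log t ≤ Real.log (P * (L / l)) := Real.log_le_log (by linarith) ht.le
    rw [Real.log_mul hP0.ne' hLl.ne', h5] at h8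
    have h9 := Real.log_le_sub_one_of_pos hP0
    have h10 : (1 - δ) * y ≤ 1 := by nlinarith
    linarith
  have hlogt0 : 0 ≤ Real.log t := Real.log_nonneg ht1
  have hle : t * Real.log t ≤ L * (P * (1 - y + z)) := by
    calc t * Real.log t ≤ (P * (L / l)) * (l - Real.log l + 1) := by gcongr
      _ = P * (L / l * (l - Real.log l) + L / l) := by ring
      _ = L * (P * (1 - y + z)) := by rw [h6, h7]; ring
  have hle2 : P * (1 - y + z) ≤ 1 - δ * y / 2 := by
    have e : P * (1 - y + z) = 1 - δ * y + z + (δ - 1) * (y * (y - z)) := by rw [hP]; ring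
    have h8 : 0 ≤ y * (y - z) := mul_nonneg (hz0.trans hzy) (by linarith)
    have h9 : (δ - 1) * (y * (y - z)) ≤ (1 + δ) * (y * (y - z)) := by
      gcongr
      linarith
    have h10 : (1 + δ) * (y * (y - z)) ≤ (1 + δ) * (y * y) := by
      have : 0 ≤ y := hz0.trans hzy
      gcongr
      linarith
    have h11 : (1 + δ) * (y * y) ≤ δ / 8 * y := by
      rw [← mul_assoc]
      exact mul_le_mul_of_nonneg_right h2 (hz0.trans hzy)
    have h12 : 0 ≤ δ * y := mul_nonneg hδ.le (hz0.trans hzy)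
    rw [e]
    linarith
  have hfac : (t ! : ℝ) ≤ Real.exp (t * Real.log t) := by
    rw [Real.exp_nat_mul, Real.exp_log (by linarith)]
    exact_mod_cast Nat.factorial_le_pow t
  calc (t ! : ℝ) * Real.exp (20 * l) ≤ Real.exp (t * Real.log t) * Real.exp (20 * l) := by gcongr
    _ = Real.exp (t * Real.log t + 20 * l) := (Real.exp_add _ _).symm
    _ ≤ Real.exp L := by
        rw [Real.exp_le_exp]
        have := mul_le_mul_of_nonneg_left hle2 hL.le
        linarith

/-- The mirror image, with T! ≥ (T / e)ᵀ: now the surviving term is + δ y, and half of it again pays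
for L²⁰. -/
theorem le_factorial (h : LogScale δ L) (T : ℕ)
    (hT : (1 + (1 + δ) * (Real.log (Real.log L) / Real.log L)) * (L / Real.log L) < T) :
    Real.exp L * L ^ 20 ≤ (T ! : ℝ) := by
  obtain ⟨l, y, z, hl, hl0, hy, hz, hz0, hzy, hy1, h1, h2, h3, h4, h5, h6, h7⟩ := h.main_ineqs
  have hδ := h.δ_pos
  have hL : 0 < L := by linarith [h.L_ge]
  have hlt : Real.log l + 1 ≤ l := by rw [hl]; exact h.lt_log
  have hL20 : L ^ 20 = Real.exp (20 * l) := by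
    rw [hl, show (20 : ℝ) = (20 : ℕ) by norm_num, Real.exp_nat_mul, Real.exp_log hL]
  rw [hL20]
  rw [← hl, ← hy] at hT
  set Q := 1 + (1 + δ) * y with hQ
  have hy0 : 0 ≤ y := hz0.trans hzy
  have hLl : 0 < L / l := by positivity
  have hQ1 : 1 ≤ Q := by
    have : 0 ≤ (1 + δ) * y := by positivity
    linarith
  have hf0 : 0 < Q * (L / l) := by positivity
  have hT0 : (0 : ℝ) < T := hf0.trans hT
  have hlogT : l - Real.log l ≤ Real.log T := by
    rw [← h5]
    refine Real.log_le_log hLl (le_trans ?_ hT.le)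
    exact le_mul_of_one_le_left hLl.le hQ1
  have hge : L * (Q * (1 - y - z)) ≤ T * Real.log T - T := by
    calc L * (Q * (1 - y - z)) = Q * (L / l * (l - Real.log l) - L / l) := by rw [h6, h7]; ring
      _ = (Q * (L / l)) * (l - Real.log l - 1) := by ring
      _ ≤ T * (Real.log T - 1) := by
          gcongr
          linarith
      _ = _ := by ring
  have hge2 : 1 + δ * y / 2 ≤ Q * (1 - y - z) := by
    have e : Q * (1 - y - z) = 1 + δ * y - z - (1 + δ) * y * y - (1 + δ) * y * z := by
      rw [hQ]; ring
    have h8 : (1 + δ) * y * y ≤ δ / 8 * y := mul_le_mul_of_nonneg_right h2 hy0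
    have h9 : (1 + δ) * y * z ≤ δ / 8 * y := mul_le_mul h2 hzy hz0 (by positivity)
    have h12 : 0 ≤ δ * y := by positivity
    rw [e]
    linarith
  have hfac : Real.exp (T * Real.log T - T) ≤ (T ! : ℝ) := by
    have := Real.pow_div_factorial_le_exp (T : ℝ) hT0.le T
    rw [div_le_iff₀ (by positivity)] at this
    rw [Real.exp_sub, Real.exp_nat_mul, Real.exp_log hT0, div_le_iff₀ (Real.exp_pos _), mul_comm]
    exact this
  refine le_trans ?_ hfac
  rw [← Real.exp_add, Real.exp_le_exp]
  have := mul_le_mul_of_nonneg_left hge2 hL.le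
  linarith

theorem threshold_le (h : LogScale δ L) {x : ℝ} (hx : x ≤ 1 + δ) :
    (1 + x * (Real.log (Real.log L) / Real.log L)) * (L / Real.log L) ≤ L := by
  obtain ⟨l, y, z, hl, hl0, hy, hz, hz0, hzy, hy1, h1, h2, h3, h4, h5, h6, h7⟩ := h.main_ineqs
  rw [← hl, ← hy]
  have hL : 0 < L := by linarith [h.L_ge]
  have h8 : x * y ≤ (1 + δ) * y := mul_le_mul_of_nonneg_right hx (hz0.trans hzy)
  calc (1 + x * y) * (L / l) ≤ l * (L / l) := by
        gcongr
        linarith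
    _ = L := by field_simp

open Filter in
theorem eventually (hδ : 0 < δ) : ∀ᶠ L : ℝ in atTop, LogScale δ L := by
  have hlog := Real.tendsto_log_atTop
  have hloglog := hlog.comp hlog
  filter_upwards [eventually_ge_atTop 2, hloglog.eventually_ge_atTop 1,
    hloglog.eventually_ge_atTop (8 / δ), hlog.eventually (eventually_mul_log_pow_le ((1 + δ) / (δ / 8)) 1),
    hlog.eventually (eventually_mul_log_pow_le 2 1), hlog.eventually_ge_atTop (1 + δ), eventually_mul_log_pow_le 20 1, eventually_mul_log_pow_le (40 / δ) 2]
    with L a1 a2 a3 a4 a5 a6 a7 a8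
  simp only [Function.comp_apply, pow_one] at a2 a3 a4 a5 a7
  refine ⟨hδ, a1, a2, ?_, by linarith, ?_, a6, a7, ?_⟩
  · rwa [div_le_iff₀ hδ, mul_comm] at a3
  · rw [div_mul_eq_mul_div, div_le_iff₀ (by positivity)] at a4
    linarith
  · rw [div_mul_eq_mul_div, div_le_iff₀ hδ] at a8
    linarith

end LogScale

end Threshold

/-! ### Choice of parameters -/

section Parameters

/-- The factor 4 gives ρᵏ ≤ n⁻⁴; two powers of `n` are spent on `K * n`. -/
theorem mul_geometric_le_inv_sq {ρ K : ℝ} (hρ0 : 0 < ρ) (hρ1 : ρ < 1) {n k : ℕ}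
    (hn : 0 < n) (hK : K ≤ n) (hk : 4 / (-Real.log ρ) * Real.log n ≤ k) :
    K * n * ρ ^ k ≤ 1 / (n : ℝ) ^ 2 := by
  have hn0 : (0 : ℝ) < n := by exact_mod_cast hn
  have hlog : 0 < -Real.log ρ := by linarith [Real.log_neg hρ0 hρ1]
  have h1 : ρ ^ k ≤ 1 / (n : ℝ) ^ 4 := by
    rw [← Real.exp_log hρ0, ← Real.exp_nat_mul, ← Real.exp_log hn0, ← Real.exp_nat_mul, one_div,
      ← Real.exp_neg, Real.exp_le_exp]
    rw [div_mul_eq_mul_div, div_le_iff₀ hlog] at hk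
    push_cast
    linarith
  calc K * n * ρ ^ k ≤ n * n * (1 / (n : ℝ) ^ 4) := by gcongr
    _ = 1 / (n : ℝ) ^ 2 := by field_simp

/-- The radius `h = ⌊5 log_{d-1} L⌋` is below half of the girth, `(d-1)^h` is at least of order
`L ^ 5`, and `d ^ h` is at most `L ^ 10`. -/
theorem radius_bounds {d : ℕ} (hd : 3 ≤ d) {L : ℝ} (hL : 1 ≤ L) {h : ℕ}
    (hh : h = ⌊5 * Real.logb ((d : ℝ) - 1) L⌋₊) :
    (2 * h : ℝ) ≤ 10 * Real.logb ((d : ℝ) - 1) L ∧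
      (1 / ((d : ℝ) - 1)) ^ h ≤ ((d : ℝ) - 1) / L ^ 5 ∧ (d : ℝ) ^ h ≤ L ^ 10 := by
  have hd' : (3 : ℝ) ≤ d := by exact_mod_cast hd
  set s : ℝ := (d : ℝ) - 1 with hs
  have hs2 : 2 ≤ s := by linarith
  have hs0 : 0 < s := by linarith
  have hL0 : 0 < L := by linarith
  have hlogb0 : 0 ≤ Real.logb s L := Real.logb_nonneg (by linarith) hL
  have hle : (h : ℝ) ≤ 5 * Real.logb s L := by
    rw [hh]
    exact Nat.floor_le (by positivity)
  have hgt : 5 * Real.logb s L < h + 1 := by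
    rw [hh]
    exact Nat.lt_floor_add_one _
  have hsL : s ^ Real.logb s L = L := Real.rpow_logb hs0 (by linarith) hL0
  have hpow : ∀ k : ℕ, s ^ ((k : ℝ) * Real.logb s L) = L ^ k := by
    intro k
    rw [mul_comm, Real.rpow_mul hs0.le, hsL, Real.rpow_natCast]
  refine ⟨by linarith, ?_, ?_⟩
  · have h1 : L ^ 5 ≤ s ^ h * s := by
      have h2 := Real.rpow_le_rpow_of_exponent_le (show 1 ≤ s by linarith) hgt.le
      have h3 := hpow 5
      push_cast at h3
      rw [h3, Real.rpow_add hs0, Real.rpow_natCast, Real.rpow_one] at h2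
      exact h2
    rw [one_div, inv_pow, inv_eq_one_div, div_le_div_iff₀ (by positivity) (by positivity)]
    linarith
  -- Comparing `d` with `(d - 1) ^ 2` doubles the exponent, whence `L ^ 10`.
  · have h1 : (d : ℝ) ≤ s ^ 2 := by nlinarith
    calc (d : ℝ) ^ h ≤ (s ^ 2) ^ h := by gcongr
      _ = s ^ ((2 * h : ℕ) : ℝ) := by rw [Real.rpow_natCast, pow_mul]
      _ ≤ s ^ (((10 : ℕ) : ℝ) * Real.logb s L) := by
          refine Real.rpow_le_rpow_of_exponent_le (by linarith) ?_
          push_cast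
          linarith
      _ = L ^ 10 := hpow 10

variable {V : Type*} [Fintype V] [DecidableEq V] {G : SimpleGraph V} [DecidableRel G.Adj]

/-- With R and M of order L, the term R² M (d-1)⁻ʰ is O(L³ · L⁻⁵) = O(L⁻²); this is where radius 5
log_{d-1} L, and so girth 10 log_{d-1} L, is used. In `K₁` the number 242 is 2 · 11², the 11 coming
from `R ≤ 11 * L` and the 2 from `η / 2` in `upper`. -/
theorem momentSetup_of_large {d n h M R : ℕ} (hd : 3 ≤ d) (hreg : G.IsRegularOfDegree d)
    {L C K₁ : ℝ} (hL2 : 2 ≤ L) (hC : 0 < C) (hn : 0 < n)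
    (hgirth : 10 * Real.logb ((d : ℝ) - 1) L < G.girth)
    (hh : h = ⌊5 * Real.logb ((d : ℝ) - 1) L⌋₊)
    (hM0 : 0 < M) (hM : (M : ℝ) ≤ (C + 1) * L) (hR : (R : ℝ) ≤ 11 * L)
    (hmix : ∀ (y : V) (k : ℕ) (p x : V), M ≤ k → G.Adj x p →
      |nbHit G d y k p x - 1 / n| ≤ 1 / (n : ℝ) ^ 2)
    (hK₁ : K₁ = 2 + 242 * (C + 1) * d) (hK₁L : K₁ ≤ L)
    (hlarge : 11 * (11 * C + 12) * L ^ 20 ≤ n) :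
    MomentSetup G d n h M R (K₁ / L ^ 2) := by
  have hL0 : 0 < L := by linarith
  have hL1 : 1 ≤ L := by linarith
  have hn0 : (0 : ℝ) < n := by exact_mod_cast hn
  have hd' : (3 : ℝ) ≤ d := by exact_mod_cast hd
  have hd1 : (0 : ℝ) < (d : ℝ) - 1 := by linarith
  have hK₁0 : 2 ≤ K₁ := by
    rw [hK₁]
    have : 0 ≤ 242 * (C + 1) * d := by positivity
    linarith
  obtain ⟨hr1, hr2, hr3⟩ := radius_bounds hd hL1 hh
  set β : ℝ := (1 / ((d : ℝ) - 1)) ^ h with hβ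
  have hβ0 : 0 ≤ β := by positivity
  have hn20 : ∀ k ≤ 20, 11 * (11 * C + 12) * L ^ k ≤ n := by
    intro k hk
    refine le_trans ?_ hlarge
    gcongr
  have hRM : 1 + (R : ℝ) * M ≤ (11 * C + 12) * L ^ 2 := by
    have h1 : (R : ℝ) * M ≤ 11 * L * ((C + 1) * L) := by gcongr
    have h2 : 1 ≤ L ^ 2 := one_le_pow₀ hL1
    linarith
  refine ⟨hreg, hd, hn, hM0, ?_, hmix, by positivity, ?_, ?_, ?_, ?_⟩
  · have : ((2 * h : ℕ) : ℝ) < G.girth := by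
      push_cast
      linarith
    exact_mod_cast this
  · rw [div_le_one (by positivity)]
    nlinarith
  · have h1 : (R : ℝ) * (1 / n) ≤ 1 / L ^ 2 := by
      rw [mul_one_div, div_le_div_iff₀ hn0 (by positivity), one_mul]
      have h2 := hn20 3 (by norm_num)
      have h3 : (R : ℝ) * L ^ 2 ≤ 11 * L * L ^ 2 := by gcongr
      have h4 : 0 ≤ C * L ^ 3 := by positivity
      have h5 : 0 ≤ L ^ 3 := by positivity
      linarith
    have h2 : (R : ℝ) * (R * (M * β)) ≤ 121 * (C + 1) * d / L ^ 2 := by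
      calc (R : ℝ) * (R * (M * β))
          ≤ 11 * L * (11 * L * ((C + 1) * L * (((d : ℝ) - 1) / L ^ 5))) := by gcongr
        _ ≤ 11 * L * (11 * L * ((C + 1) * L * (d / L ^ 5))) := by
            gcongr
            linarith
        _ = 121 * (C + 1) * d / L ^ 2 := by
            field_simp
            ring
    calc (R : ℝ) * (1 / n + R * (M * β)) = R * (1 / n) + R * (R * (M * β)) := by ring
      _ ≤ 1 / L ^ 2 + 121 * (C + 1) * d / L ^ 2 := add_le_add h1 h2
      _ = K₁ / L ^ 2 / 2 := by rw [hK₁]; ring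
  · rw [mul_div_assoc', div_le_div_iff₀ hn0 (by positivity)]
    have h2 := hn20 5 (by norm_num)
    calc (R : ℝ) * (1 + R * M) * L ^ 2 ≤ 11 * L * ((11 * C + 12) * L ^ 2) * L ^ 2 := by gcongr
      _ = 11 * (11 * C + 12) * L ^ 5 := by ring
      _ ≤ n := h2
      _ ≤ K₁ * n := by nlinarith
  · rw [div_le_one hn0]
    have h2 := hn20 2 (by norm_num)
    have h3 : 0 ≤ (11 * C + 12) * L ^ 2 := by positivity
    linarith

theorem two_div_factorial_le {m : ℕ} {L : ℝ} (hL : 0 < L) (hm : L ≤ m) :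
    (2 : ℝ) / (2 * m + 1)! ≤ 2 / L ^ 2 := by
  have h1 : m * m ≤ (2 * m + 1)! := by
    rcases m with - | m
    · simp
    · rw [Nat.factorial_succ, show 2 * (m + 1) = (2 * m + 1) + 1 by ring, Nat.factorial_succ]
      have := Nat.factorial_pos (2 * m + 1)
      calc (m + 1) * (m + 1) ≤ (2 * m + 1 + 1 + 1) * ((2 * m + 1 + 1) * 1) :=
            Nat.mul_le_mul (by omega) (by omega)
        _ ≤ _ := Nat.mul_le_mul_left _ (Nat.mul_le_mul_left _ this)
  have h2 : ((m : ℝ) * m) ≤ (2 * m + 1)! := by exact_mod_cast h1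
  refine div_le_div_of_nonneg_left (by norm_num) (by positivity) (le_trans ?_ h2)
  rw [sq]
  gcongr

/-- The two assertions about the numbers of visits, for one graph whose size is large. -/
theorem nbProb_ge_of_large {d n h M : ℕ} {δ C K₁ K₂ K₃ ε : ℝ} (hε : 0 < ε) (hd : 3 ≤ d)
    (hreg : G.IsRegularOfDegree d) (hcard : Fintype.card V = n) (hn : 0 < n)
    (hscale : LogScale δ (Real.log n)) (hC : 0 < C)
    (hgirth : 10 * Real.logb ((d : ℝ) - 1) (Real.log n) < G.girth)
    (hh : h = ⌊5 * Real.logb ((d : ℝ) - 1) (Real.log n)⌋₊) (hh0 : 0 < h)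
    (hM0 : 0 < M) (hM : (M : ℝ) ≤ (C + 1) * Real.log n)
    (hmix : ∀ (y : V) (k : ℕ) (p x : V), M ≤ k → G.Adj x p →
      |nbHit G d y k p x - 1 / n| ≤ 1 / (n : ℝ) ^ 2)
    (hK₁ : K₁ = 2 + 242 * (C + 1) * d) (hK₂ : K₂ = 1 + 22 * (C + 3))
    (hK₃ : K₃ = 44 + 99 * K₁ + 27 * K₂) (hK₁L : 6 + 9 * K₁ ≤ Real.log n)
    (hlarge : 11 * (11 * C + 12) * Real.log n ^ 20 ≤ n)
    (hε₁ : 6 * K₃ / ε * Real.log (Real.log n) ^ 2 ≤ Real.log n)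
    (hε₂ : 2 * K₂ / ε ≤ Real.log n) (w₀ : V) :
    1 - ε ≤ nbProb G w₀ n
      {w | ∀ t : ℕ,
        ((t : ℝ) < visitThreshold n (1 - δ) →
          |(visitedExactly w t : ℝ) / ((n : ℝ) / (Real.exp 1 * (t ! : ℝ))) - 1| ≤
            1 / Real.log (Real.log (Real.log n))) ∧
        (visitThreshold n (1 + δ) < (t : ℝ) → visitedExactly w t = 0)} := by
  classical
  have hn0 : (0 : ℝ) < n := by exact_mod_cast hn
  have hexp : Real.exp (Real.log n) = n := Real.exp_log hn0
  have hδ := hscale.δ_pos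
  unfold visitThreshold
  generalize Real.log n = L at *
  have hL2 := hscale.L_ge
  have hL0 : 0 < L := by linarith
  have hL1 : 1 ≤ L := by linarith
  set m := ⌈L⌉₊ with hm
  have hmL : L ≤ m := Nat.le_ceil L
  have hmL' : (m : ℝ) ≤ L + 1 := (Nat.ceil_lt_add_one hL0.le).le
  -- For `t ≤ L` and `m ≤ L + 1` the sieve needs order `2 * (t + 2 * m + 1) ≤ 6 * L + 6`, which is
  -- below `10 * L` since `L ≥ 2`.
  set R := ⌈10 * L⌉₊ with hRdef
  have hRL : 10 * L ≤ R := Nat.le_ceil _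
  have hRL' : (R : ℝ) ≤ 11 * L := by
    have := (Nat.ceil_lt_add_one (show 0 ≤ 10 * L by positivity)).le
    linarith
  have hK₁0 : 2 ≤ K₁ := by
    rw [hK₁]
    have : 0 ≤ 242 * (C + 1) * d := by positivity
    linarith
  have hK₂0 : 1 ≤ K₂ := by rw [hK₂]; linarith
  have hS := momentSetup_of_large hd hreg hL2 hC hn hgirth hh hM0 hM hRL' hmix hK₁
    (by linarith) hlarge
  obtain ⟨-, -, hD⟩ := radius_bounds hd hL1 hh
  have hn20 : ∀ k ≤ 20, 3 * L ^ k ≤ n := by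
    intro k hk
    calc 3 * L ^ k ≤ 11 * (11 * C + 12) * L ^ 20 := by
          gcongr
          linarith
      _ ≤ n := hlarge
  have hB : 2 * d ^ h < n := by
    have h1 := hn20 10 (by norm_num)
    have h2 : ((2 * d ^ h : ℕ) : ℝ) < n := by
      push_cast
      have : 0 < L ^ 10 := by positivity
      linarith
    exact_mod_cast h2
  set F₁ := (1 + (1 - δ) * (Real.log (Real.log L) / Real.log L)) * (L / Real.log L) with hF₁
  set F₂ := (1 + (1 + δ) * (Real.log (Real.log L) / Real.log L)) * (L / Real.log L) with hF₂
  have hF₁L : F₁ ≤ L := hscale.threshold_le (by linarith)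
  have hF₂L : F₂ ≤ L := hscale.threshold_le le_rfl
  set T := ⌊F₂⌋₊ + 1 with hT
  have hTF : F₂ < T := by
    rw [hT]
    push_cast
    exact Nat.lt_floor_add_one F₂
  have hTR : T ≤ R := by
    have h1 : (⌊F₂⌋₊ : ℝ) ≤ L := by
      rcases le_total 0 F₂ with h0 | h0
      · exact (Nat.floor_le h0).trans hF₂L
      · rw [Nat.floor_of_nonpos h0]
        simpa using hL0.le
    have h2 : (T : ℝ) ≤ R := by
      rw [hT]
      push_cast
      linarith
    exact_mod_cast h2
  set S := (Finset.range (⌊L⌋₊ + 1)).filter fun t : ℕ => (t : ℝ) < F₁ with hSdef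
  have hmemS : ∀ t : ℕ, t ∈ S ↔ (t : ℝ) < F₁ := by
    intro t
    rw [hSdef, Finset.mem_filter, Finset.mem_range]
    exact and_iff_right_of_imp fun ht => Nat.lt_succ_of_le (Nat.le_floor (ht.le.trans hF₁L))
  have hScard : (S.card : ℝ) ≤ 3 / 2 * L := by
    have h1 : S.card ≤ ⌊L⌋₊ + 1 := (Finset.card_filter_le _ _).trans (Finset.card_range _).le
    have h2 : (S.card : ℝ) ≤ (⌊L⌋₊ : ℝ) + 1 := by exact_mod_cast h1
    have h3 := Nat.floor_le hL0.le
    linarith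
  have hQ : 1 + 2 * ((M : ℝ) + 2) * R ≤ K₂ * L ^ 2 := by
    have h1 : (M : ℝ) + 2 ≤ (C + 3) * L := by linarith
    have h2 : 2 * ((M : ℝ) + 2) * R ≤ 2 * ((C + 3) * L) * (11 * L) := by gcongr
    have h3 : 1 ≤ L ^ 2 := one_le_pow₀ hL1
    rw [hK₂]
    linarith
  have hl2 := hscale.one_le
  set l2 := Real.log (Real.log L) with hl2def
  have hl20 : 0 < l2 := by linarith
  have hL2' : 0 < L ^ 2 := by positivity
  have h612 : (6 + 9 * K₁) / L ^ 2 ≤ 1 := by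
    rw [div_le_one hL2']
    nlinarith
  have hsum : 2 / L ^ 2 + 3 * (K₁ / L ^ 2) = (6 + 9 * K₁) / L ^ 2 / 3 := by ring
  refine le_trans ?_ (hS.nbProb_ge hcard hh0 hB w₀ S (m := m) (T := T) (τ := 2 / L ^ 2)
    (a := 1 / l2) (v := K₃ / L ^ 2) (fun t ht => ?_) hTR (two_div_factorial_le hL0 hmL) ?_ ?_
    (by positivity) (fun t ht => ?_) _ fun w hw => ?_)
  -- There are O(L) values of `t`, each failing with probability at most `K₃ * l2 ^ 2 / L ^ 2`; a
  -- variance of order L⁻² is what the union bound requires.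
  · have h1 : (S.card : ℝ) * (K₃ / L ^ 2 / (1 / l2) ^ 2) ≤ ε / 2 := by
      have hK₃0 : 0 ≤ K₃ := by rw [hK₃]; linarith
      have h2 : l2 ^ 2 ≤ Real.log L ^ 2 := by
        have := hscale.lt_log
        gcongr
        linarith
      have h3 : 6 * K₃ * l2 ^ 2 ≤ ε * L := by
        rw [div_mul_eq_mul_div, div_le_iff₀ hε] at hε₁
        have h4 : 6 * K₃ * l2 ^ 2 ≤ 6 * K₃ * Real.log L ^ 2 := by gcongr
        linarith
      calc (S.card : ℝ) * (K₃ / L ^ 2 / (1 / l2) ^ 2)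
          ≤ 3 / 2 * L * (K₃ / L ^ 2 / (1 / l2) ^ 2) := by gcongr
        _ = (6 * K₃ * l2 ^ 2) / (4 * L) := by
            field_simp
            ring
        _ ≤ (ε * L) / (4 * L) := by gcongr
        _ = ε / 4 := by field_simp
        _ ≤ ε / 2 := by linarith
    have h2 : (n : ℝ) * ((1 + 2 * (M + 2) * R) / T !) ≤ ε / 2 := by
      have h3 := hscale.le_factorial T hTF
      rw [hexp] at h3
      have h4 : K₂ ≤ ε / 2 * L := by
        rw [div_le_iff₀ hε] at hε₂
        linarith
      calc (n : ℝ) * ((1 + 2 * (M + 2) * R) / T !) ≤ n * (K₂ * L ^ 2 / (n * L ^ 20)) := by gcongr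
        _ = K₂ / L ^ 18 := by field_simp
        _ ≤ (ε / 2 * L) / L ^ 18 := by gcongr
        _ ≤ (ε / 2 * L ^ 18) / L ^ 18 := by
            gcongr
            exact le_self_pow₀ hL1 (by norm_num)
        _ = ε / 2 := by field_simp
    linarith
  · have h1 : (t : ℝ) ≤ L := (((hmemS t).1 ht).le).trans hF₁L
    have h2 : ((2 * (t + 2 * m + 1) : ℕ) : ℝ) ≤ R := by
      push_cast
      linarith
    exact_mod_cast h2
  · refine le_trans ?_ h612
    gcongr
    linarith
  · rw [hsum]
    linarith
  · have h1 := hscale.factorial_mul_le t ((hmemS t).1 ht)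
    rw [hexp] at h1
    have h2 : (t ! : ℝ) / n ≤ 1 / L ^ 20 := by
      rw [div_le_div_iff₀ hn0 (by positivity)]
      linarith
    have h3 : 27 * (d : ℝ) ^ h * (1 + 2 * (M + 2) * R) * (t ! / n) ≤ 27 * K₂ / L ^ 2 := by
      calc _ ≤ 27 * L ^ 10 * (K₂ * L ^ 2) * (1 / L ^ 20) := by gcongr
        _ = 27 * K₂ / L ^ 8 := by field_simp
        _ ≤ 27 * K₂ / L ^ 2 := by
            gcongr
            norm_num
    have h4 : (d : ℝ) ^ h / n ≤ 1 / L ^ 2 := by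
      rw [div_le_div_iff₀ hn0 hL2']
      calc (d : ℝ) ^ h * L ^ 2 ≤ L ^ 10 * L ^ 2 := by gcongr
        _ = L ^ 12 := by ring
        _ ≤ 1 * n := by
            have := hn20 12 (by norm_num)
            have h5 : 0 < L ^ 12 := by positivity
            linarith
    have e : K₃ / L ^ 2
        = 21 * (2 / L ^ 2) + 99 * (K₁ / L ^ 2) + 27 * K₂ / L ^ 2 + 2 * (1 / L ^ 2) := by
      rw [hK₃]; ring
    rw [e]
    linarith
  · simp only [Set.mem_ofPred_eq, not_forall, not_and_or] at hw
    obtain ⟨t, ⟨ht, hlt⟩ | ⟨ht, hne⟩⟩ := hw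
    · exact Or.inl ⟨t, (hmemS t).2 ht, not_le.1 hlt⟩
    · right
      obtain ⟨u, hu⟩ := Finset.card_pos.1 (Nat.pos_of_ne_zero hne)
      refine ⟨u, ?_⟩
      rw [(Finset.mem_filter.1 hu).2, hT]
      -- The value `t = 0` must be excluded for this form of the floor inequality: `F₂` is
      -- nonnegative.
      exact Nat.succ_le_of_lt ((Nat.floor_lt' (by
        rintro rfl
        have : 0 ≤ F₂ := by
          rw [hF₂]
          have : 0 < Real.log L := by linarith [hscale.lt_log]
          positivity
        simp at ht
        linarith)).2 ht)

end Parameters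

end

/-! ### The theorem -/

theorem theorem2 (d : ℕ) (hd : 3 ≤ d) (lam : ℝ) (hlam : lam < d) (δ : ℝ) (hδ : 0 < δ) :
    ∀ ε : ℝ, 0 < ε → ∃ n₀ : ℕ, ∀ n : ℕ, n₀ ≤ n →
      ∀ (V : Type*) [Fintype V] [DecidableEq V] (G : SimpleGraph V) [DecidableRel G.Adj]
        (lamG : ℝ), IsNDLambdaGraph G n d lamG → lamG ≤ lam →
      10 * Real.logb ((d : ℝ) - 1) (Real.log n) < (G.girth : ℝ) →
      ∀ w₀ : V,
        1 - ε ≤ nbProb G w₀ n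
          {w | ∀ t : ℕ,
            ((t : ℝ) < visitThreshold n (1 - δ) →
              |(visitedExactly w t : ℝ) / ((n : ℝ) / (Real.exp 1 * (t ! : ℝ))) - 1| ≤
                1 / Real.log (Real.log (Real.log n))) ∧
            (visitThreshold n (1 + δ) < (t : ℝ) → visitedExactly w t = 0)} := by
  intro ε hε
  -- The mixing constants depend only on `d` and `lam`, so `n₀` can be fixed before the graph and
  -- the start.
  obtain ⟨ρ, K, hρ0, hρ1, hK, hmix⟩ := exists_nbHit_mixing d hd lam hlam
  set C : ℝ := 4 / (-Real.log ρ) with hC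
  have hC0 : 0 < C := div_pos (by norm_num) (by linarith [Real.log_neg hρ0 hρ1])
  set K₁ : ℝ := 2 + 242 * (C + 1) * d with hK₁
  set K₂ : ℝ := 1 + 22 * (C + 3) with hK₂
  set K₃ : ℝ := 44 + 99 * K₁ + 27 * K₂ with hK₃
  have hlog : Filter.Tendsto (fun n : ℕ => Real.log n) Filter.atTop Filter.atTop :=
    Real.tendsto_log_atTop.comp tendsto_natCast_atTop_atTop
  have hev : ∀ᶠ n : ℕ in Filter.atTop, 0 < n ∧ K ≤ n ∧ (d : ℝ) ≤ Real.log n ∧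
      LogScale δ (Real.log n) ∧ 6 + 9 * K₁ ≤ Real.log n ∧
      11 * (11 * C + 12) * Real.log n ^ 20 ≤ n ∧
      6 * K₃ / ε * Real.log (Real.log n) ^ 2 ≤ Real.log n ∧ 2 * K₂ / ε ≤ Real.log n := by
    filter_upwards [Filter.eventually_gt_atTop 0,
      tendsto_natCast_atTop_atTop.eventually_ge_atTop K, hlog.eventually_ge_atTop (d : ℝ),
      hlog.eventually (LogScale.eventually hδ), hlog.eventually_ge_atTop (6 + 9 * K₁),
      tendsto_natCast_atTop_atTop.eventually
        (eventually_mul_log_pow_le (11 * (11 * C + 12)) 20),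
      hlog.eventually (eventually_mul_log_pow_le (6 * K₃ / ε) 2),
      hlog.eventually_ge_atTop (2 * K₂ / ε)] with n h1 h2 h3 h4 h5 h6 h7 h8
    exact ⟨h1, h2, h3, h4, h5, h6, h7, h8⟩
  obtain ⟨n₀, hn₀⟩ := Filter.eventually_atTop.1 hev
  refine ⟨n₀, fun n hn V _ _ G _ lamG hG hle hgirth w₀ => ?_⟩
  obtain ⟨hn0, hKn, hdL, hscale, h5, h6, h7, h8⟩ := hn₀ n hn
  have hd' : (3 : ℝ) ≤ d := by exact_mod_cast hd
  have hL0 : 0 < Real.log n := by linarith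
  have hCL : 0 < C * Real.log n := by positivity
  refine nbProb_ge_of_large (M := ⌈C * Real.log n⌉₊) hε hd hG.regular hG.card_eq hn0 hscale hC0
    hgirth rfl ?_ (Nat.ceil_pos.2 hCL) ?_ ?_ hK₁ hK₂ hK₃ h5 h6 h7 h8 w₀
  -- The radius is positive because `log n ≥ d` makes the logarithm to base `d - 1` at least 1.
  · rw [Nat.floor_pos]
    have h9 : 1 ≤ Real.logb ((d : ℝ) - 1) (Real.log n) := by
      rw [Real.le_logb_iff_rpow_le (by linarith) hL0, Real.rpow_one]
      linarith
    linarith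
  · have := (Nat.ceil_lt_add_one hCL.le).le
    linarith
  · intro y k p x hk hxp
    exact (hmix V G n lamG hG hle y k p x hxp).trans
      (mul_geometric_le_inv_sq hρ0 hρ1 hn0 hKn (Nat.ceil_le.1 hk))
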